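/- **Setup.** Let $X, X_1, X_2, \ldots$ be i.i.d. with law $P$ on a measurable space $\mathcal X$. For $k=1,\ldots,K$ let $\Theta_k\subseteq\mathbb R^{d_k}$ be open and let the loss $\ell_k:\mathcal X\times\Theta_k\to\mathbb R$ be measurable. Fix $\theta_k^*\in\arg\min_{\theta\in\Theta_k} E\,\ell_k(X;\theta)$ and put $\mu^0_k = E\,\ell_k(X;\theta^*_k)$ and $\Sigma^0=\mathrm{Cov}\big(\ell_1(X;\theta_1^*),\ldots,\ell_K(X;\theta_K^*)\big)$. Assume: 1. $E\,\ell_k(X;\theta_k^*)^2<\infty$ for all $k$, and $\Sigma^0$ is positive definite. 2. For each $k$ there is $r>0$ with $B_r(\theta_k^*)\subseteq\Theta_k$ such that: $E|\ell_k(X;\theta)|<\infty$ for all $\theta\in B_r(\theta^*_k)$; for every $x$, $\theta\mapsto\ell_k(x;\theta)$ is twice continuously differentiable on $B_r(\theta_k^*)$; there is $H:\mathcal X\to[0,\infty)$ with $E\,H(X)<\infty$ and $\|\nabla^2_\theta\ell_k(x;\theta)\|\le H(x)$ for all $x$ and all $\theta\in B_r(\theta_k^*)$; and $E\|\nabla_\theta\ell_k(X;\theta^*_k)\|^2<\infty$.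 3. $\hat\theta_k=\hat\theta_k(X_1,\ldots,X_n)\in\Theta_k$ is an estimator with $\|\hat\theta_k-\theta_k^*\|=O_p(1/\sqrt n)$, for each $k$. Let $Z_i=(Z_{i1},\ldots,Z_{iK})^{\mathsf T}$ for $i=1,\ldots,n$, where either $Z_{ik}=\ell_k(X_i;\hat\theta_k)$ for all $i,k$, or (bias-corrected) $Z_{ik}=\ell_k(X_i;\hat\theta_k)+d_k/(2n)$ for all $i,k$. Put $\bar Z_n=\frac1n\sum_i Z_i$ and $S_n=\frac1n\sum_i(Z_i-\bar Z_n)(Z_i-\bar Z_n)^{\mathsf T}$. Given $\mu_0\in\mathbb R^K$, $\lambda_0>0$, $\Psi_0$ positive definite and $\nu_0>K-1$, put $\lambda_n=\lambda_0+n$, $\nu_n=\nu_0+n$, $\mu_n=(\lambda_0\mu_0+n\bar Z_n)/\lambda_n$ and $\Psi_n=\Psi_0+nS_n+\frac{\lambda_0n}{\lambda_n}(\bar Z_n-\mu_0)(\bar Z_n-\mu_0)^{\mathsf T}$. The normal-inverse-Wishart posterior $\mathrm{NIW}(\mu_n,\lambda_n,\Psi_n,\nu_n)$ is the law of $(\mu',\Sigma')$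 where $\Sigma'\sim\mathrm{InverseWishart}(\Psi_n,\nu_n)$ and $\mu'\mid\Sigma'\sim\mathcal N(\mu_n,\Sigma'/\lambda_n)$. For a complexity function $c:\{1,\ldots,K\}\to[0,\infty)$, $\delta\ge0$ and $\mu\in\mathbb R^K$ let $M_\delta(\mu)=\{k:\mu_k\le\min_j\mu_j+\delta\}$, $c^*_\delta(\mu)=\min\{c(k):k\in M_\delta(\mu)\}$, and $M^*_\delta(\mu)=\arg\min_{k:\,c(k)=c^*_\delta(\mu)}\mu_k$ (the set of all minimisers). For $\alpha_n\ge0$ let $r_{nk}(\mu)=\exp\big(-\alpha_n(\mu_k-\min_{j:\,c(j)=c(k)}\mu_j)\big)$. Fix $T\ge1$. For each $n$ let $(\mu^{(t)},\Sigma^{(t)})$, $t=1,\ldots,T$, be posterior draws, that is, each has conditional law $\mathrm{NIW}(\mu_n,\lambda_n,\Psi_n,\nu_n)$ given $Z_1,\ldots,Z_n$ (for instance, they are conditionally i.i.d.). The Monte Carlo SLC (smooth LaD criterion) estimates are $$\hat w_\delta(k)=\Big(\frac1T\sum_{t=1}^T\mathbf 1\big(c^*_\delta(\mu^{(t)})=c(k)\big)\Big)\Big(\frac1T\sum_{t=1}^T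 r_{nk}(\mu^{(t)})\Big).$$ **Theorem.** Assume the above, suppose $\delta\ne\mu^0_k-\min_j\mu^0_j$ for all $k=1,\ldots,K$, and let $\alpha_n\to\infty$ with $\alpha_n=o(\sqrt n)$. Then, with $T$ held fixed, for every $k\in\{1,\ldots,K\}$, $$\hat w_\delta(k)\xrightarrow[n\to\infty]{\mathrm p}\mathbf 1\big(k\in M^*_\delta(\mu^0)\big).$$ -/

import Mathlib

open MeasureTheory ProbabilityTheory Filter Topology Asymptotics
open scoped NNReal ENNReal Gradient

noncomputable section

namespace LaD

/-! ### Model selection functionals of a vector `μ ∈ ℝ^K` -/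

/-- The set `M_δ(μ)` of `δ`-optimal models. -/
def deltaOptimal {K : ℕ} (δ : ℝ) (μ : Fin K → ℝ) : Set (Fin K) :=
  {k | μ k ≤ (⨅ j, μ j) + δ}

/-- The smallest complexity `c*_δ(μ)` attained by a `δ`-optimal model. -/
def minComplexity {K : ℕ} (c : Fin K → ℝ≥0) (δ : ℝ) (μ : Fin K → ℝ) : ℝ≥0 :=
  sInf (c '' deltaOptimal δ μ)

/-- The best minimal-complexity `δ`-optimal models,
`M*_δ(μ) = argmin {μ_k : c(k) = c*_δ(μ)}`. -/
def bestModels {K : ℕ} (c : Fin K → ℝ≥0) (δ : ℝ) (μ : Fin K → ℝ) : Set (Fin K) :=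
  {k | c k = minComplexity c δ μ ∧ ∀ j, c j = minComplexity c δ μ → μ k ≤ μ j}

/-- The within-class soft-selection score
`exp (-a (μ_k - min {μ_j : c(j) = c(k)}))` at temperature `a`. -/
def softScore {K : ℕ} (c : Fin K → ℝ≥0) (a : ℝ) (μ : Fin K → ℝ) (k : Fin K) : ℝ :=
  Real.exp (-a * (μ k - ⨅ j : {j : Fin K // c j = c k}, μ j))

/-- The between-class factor: the fraction of the draws `m 1, …, m T` with
`c*_δ(m t) = c(k)`. -/
def betweenEst {K T : ℕ} (c : Fin K → ℝ≥0) (δ : ℝ) (m : Fin T → Fin K → ℝ) (k : Fin K) : ℝ :=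
  (1 / (T : ℝ)) * ∑ t, Set.indicator {μ | minComplexity c δ μ = c k} (fun _ => (1 : ℝ)) (m t)

/-- The within-class factor: the average soft-selection score over the draws. -/
def withinEst {K T : ℕ} (c : Fin K → ℝ≥0) (a : ℝ) (m : Fin T → Fin K → ℝ) (k : Fin K) : ℝ :=
  (1 / (T : ℝ)) * ∑ t, softScore c a (m t) k

/-- The Monte Carlo SLC estimate computed from the draws `m 1, …, m T`. -/
def slcEst {K T : ℕ} (c : Fin K → ℝ≥0) (δ a : ℝ) (m : Fin T → Fin K → ℝ) (k : Fin K) : ℝ :=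
  betweenEst c δ m k * withinEst c a m k

/-! ### Sample statistics and posterior hyperparameters -/

/-- Sample mean of the rows of a data matrix. -/
def sampleMean {n K : ℕ} (z : Fin n → Fin K → ℝ) : Fin K → ℝ :=
  (1 / (n : ℝ)) • ∑ i, z i

/-- Sample covariance (with divisor `n`) of the rows of a data matrix. -/
def sampleCov {n K : ℕ} (z : Fin n → Fin K → ℝ) : Matrix (Fin K) (Fin K) ℝ :=
  (1 / (n : ℝ)) • ∑ i, Matrix.vecMulVec (z i - sampleMean z) (z i - sampleMean z)

/-- `μ_n = (λ₀ μ₀ + n Z̄_n) / λ_n`, where `λ_n = λ₀ + n`. -/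
def postMean {n K : ℕ} (m₀ : Fin K → ℝ) (l₀ : ℝ) (z : Fin n → Fin K → ℝ) : Fin K → ℝ :=
  (1 / (l₀ + n)) • (l₀ • m₀ + (n : ℝ) • sampleMean z)

/-- `Ψ_n = Ψ₀ + n S_n + (λ₀ n / λ_n) (Z̄_n - μ₀) (Z̄_n - μ₀)ᵀ`. -/
def postScale {n K : ℕ} (m₀ : Fin K → ℝ) (l₀ : ℝ) (Ψ₀ : Matrix (Fin K) (Fin K) ℝ)
    (z : Fin n → Fin K → ℝ) : Matrix (Fin K) (Fin K) ℝ :=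
  Ψ₀ + (n : ℝ) • sampleCov z +
    (l₀ * n / (l₀ + n)) • Matrix.vecMulVec (sampleMean z - m₀) (sampleMean z - m₀)

/-! ### The Wishart, inverse-Wishart and normal-inverse-Wishart distributions -/

/-- The symmetric matrix with the given entries on and above the diagonal. -/
def symMatrix {K : ℕ} (v : {p : Fin K × Fin K // p.1 ≤ p.2} → ℝ) : Matrix (Fin K) (Fin K) ℝ :=
  Matrix.of fun i j => v ⟨(min i j, max i j), min_le_max⟩

/-- The Wishart density with scale matrix `V` and `ν` degrees of freedom, up to its normalising
constant: `|W|^((ν - K - 1)/2) exp (-tr (V⁻¹ W) / 2)` for positive definite `W`. -/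
def wishartKernel {K : ℕ} (V : Matrix (Fin K) (Fin K) ℝ) (ν : ℝ)
    (v : {p : Fin K × Fin K // p.1 ≤ p.2} → ℝ) : ℝ≥0∞ :=
  Set.indicator {v | (symMatrix v).PosDef}
    (fun v => ENNReal.ofReal ((symMatrix v).det ^ ((ν - K - 1) / 2) *
      Real.exp (-(V⁻¹ * symMatrix v).trace / 2))) v

/-- The Wishart distribution, as a law on the entries on and above the diagonal: the probability
measure whose Lebesgue density is proportional to `wishartKernel V ν`. -/
def wishart {K : ℕ} (V : Matrix (Fin K) (Fin K) ℝ) (ν : ℝ) :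
    Measure ({p : Fin K × Fin K // p.1 ≤ p.2} → ℝ) :=
  (∫⁻ v, wishartKernel V ν v)⁻¹ • (volume.withDensity (wishartKernel V ν))

/-- The inverse-Wishart distribution with inverse scale matrix `Ψ`: the law of `W⁻¹`, where `W`
has the Wishart distribution with scale matrix `Ψ⁻¹`. -/
def invWishart {K : ℕ} (Ψ : Matrix (Fin K) (Fin K) ℝ) (ν : ℝ) : Measure (Fin K → Fin K → ℝ) :=
  (wishart Ψ⁻¹ ν).map fun v i j => (symMatrix v)⁻¹ i j

/-- Given `Z`, the pair `(mu, Sig)` has the normal-inverse-Wishart distribution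
`NIW(m(Z), l, Ψ(Z), ν)`: given `Z`, `Sig` is inverse-Wishart with parameters `Ψ(Z)` and `ν`, and
given `(Z, Sig)`, `mu` is normal with mean `m(Z)` and covariance matrix `Sig / l`. -/
structure IsNIWDraw {Ω 𝓩 : Type*} [MeasurableSpace Ω] [MeasurableSpace 𝓩] {K : ℕ}
    (Pr : Measure Ω) [IsProbabilityMeasure Pr] (Z : Ω → 𝓩) (m : 𝓩 → Fin K → ℝ) (l : ℝ)
    (Ψ : 𝓩 → Matrix (Fin K) (Fin K) ℝ) (ν : ℝ)
    (mu : Ω → EuclideanSpace ℝ (Fin K)) (Sig : Ω → Fin K → Fin K → ℝ) : Prop where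
  measurable_mu : Measurable mu
  measurable_Sig : Measurable Sig
  law_Sig : ∀ᵐ z ∂(Pr.map Z), condDistrib Sig Z Pr z = invWishart (Ψ z) ν
  law_mu : ∀ᵐ p ∂(Pr.map fun ω => (Z ω, Sig ω)),
    condDistrib mu (fun ω => (Z ω, Sig ω)) Pr p =
      multivariateGaussian (WithLp.toLp 2 (m p.1)) ((1 / l) • Matrix.of p.2)

/-! ### Losses and regularity conditions -/

/-- Extended expectation `E f⁺ - E f⁻ ∈ [-∞, ∞]`. When both parts are infinite the expectation does
not exist; the value is then `+∞` (as `⊤ - ⊤ = ⊥` in `EReal`), so that such a point imposes no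
constraint on a minimiser. -/
def extExp {𝓧 : Type*} [MeasurableSpace 𝓧] (P : Measure 𝓧) (f : 𝓧 → ℝ) : EReal :=
  -(((∫⁻ x, ENNReal.ofReal (-f x) ∂P : ℝ≥0∞) : EReal) -
    ((∫⁻ x, ENNReal.ofReal (f x) ∂P : ℝ≥0∞) : EReal))

/-- Regularity of one model with open parameter set `Θ ⊆ ℝ^d`, loss `ℓ` and population minimiser
`θs`, when the observations have law `P`. The norm of the second derivative is the operator norm;
replacing it by any other norm on Hessian matrices gives the same condition. -/
structure RegularModel {𝓧 : Type*} [MeasurableSpace 𝓧] (P : Measure 𝓧) {d : ℕ}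
    (Θ : Set (EuclideanSpace ℝ (Fin d))) (ℓ : 𝓧 → EuclideanSpace ℝ (Fin d) → ℝ)
    (θs : EuclideanSpace ℝ (Fin d)) : Prop where
  isOpen : IsOpen Θ
  measurable_loss : Measurable fun p : 𝓧 × Θ => ℓ p.1 p.2
  mem : θs ∈ Θ
  isMin : ∀ θ ∈ Θ, extExp P (fun x => ℓ x θs) ≤ extExp P (fun x => ℓ x θ)
  locallyRegular : ∃ r > 0, Metric.ball θs r ⊆ Θ ∧
    (∀ θ ∈ Metric.ball θs r, Integrable (fun x => ℓ x θ) P) ∧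
    (∀ x, ContDiffOn ℝ 2 (ℓ x) (Metric.ball θs r)) ∧
    (∃ H : 𝓧 → ℝ, (∀ x, 0 ≤ H x) ∧ Integrable H P ∧
      ∀ x, ∀ θ ∈ Metric.ball θs r, ‖iteratedFDeriv ℝ 2 (ℓ x) θ‖ ≤ H x)
  gradient_sq : Integrable (fun x => ‖∇ (ℓ x) θs‖ ^ 2) P

/-- `Y_n = O_p(a_n)`. -/
def IsBigOInProb {Ω : Type*} [MeasurableSpace Ω] (Pr : Measure Ω) (Y : ℕ → Ω → ℝ) (a : ℕ → ℝ) :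
    Prop :=
  ∀ ε : ℝ, 0 < ε → ∃ M : ℝ, ∀ᶠ n in atTop, Pr {ω | M * a n < |Y n ω|} ≤ ENNReal.ofReal ε

section Loss

variable {𝓧 : Type*} {K : ℕ} {d : Fin K → ℕ}

/-- `μ⁰_k = E ℓ_k(X; θ*_k)`. -/
def trueMean [MeasurableSpace 𝓧] (P : Measure 𝓧)
    (ℓ : ∀ k, 𝓧 → EuclideanSpace ℝ (Fin (d k)) → ℝ)
    (θs : ∀ k, EuclideanSpace ℝ (Fin (d k))) : Fin K → ℝ :=
  fun k => ∫ x, ℓ k x (θs k) ∂P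

/-- `Σ⁰ = Cov (ℓ_1(X; θ*_1), …, ℓ_K(X; θ*_K))`. -/
def trueCov [MeasurableSpace 𝓧] (P : Measure 𝓧)
    (ℓ : ∀ k, 𝓧 → EuclideanSpace ℝ (Fin (d k)) → ℝ)
    (θs : ∀ k, EuclideanSpace ℝ (Fin (d k))) : Matrix (Fin K) (Fin K) ℝ :=
  Matrix.of fun j k => cov[fun x => ℓ j x (θs j), fun x => ℓ k x (θs k); P]

/-- The `n × K` matrix of values `Z_{ik} = ℓ_k(x_i; θ̂_k(x_1, …, x_n)) + b_k / (2 n)`. -/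
def ladMatrix (ℓ : ∀ k, 𝓧 → EuclideanSpace ℝ (Fin (d k)) → ℝ)
    (θhat : ∀ k, ∀ n : ℕ, (Fin n → 𝓧) → EuclideanSpace ℝ (Fin (d k))) (b : Fin K → ℝ)
    (n : ℕ) (x : Fin n → 𝓧) : Fin n → Fin K → ℝ :=
  fun i k => ℓ k (x i) (θhat k n x) + b k / (2 * n)

end Loss

end LaD

end

/-!
The posterior draw `μ⁽ᵗ⁾` is shown to lie within `O_p(1/√n)` of the population means `μ⁰`. Since
`α_n = o(√n)`, this gives `α_n (μ⁽ᵗ⁾ - μ⁰) → 0` in probability, and the estimate is, in the sense of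
`tendsto_slcEst`, continuous along such sequences: `δ` is not one of the gaps of `μ⁰`, so the
`δ`-optimal set of the draws is eventually that of `μ⁰`; and within the complexity class of `k` the
exponent `-α_n (μ_k - min μ_j)` tends to `0` if `k` is a minimiser for `μ⁰` and to `-∞` otherwise.

The rate has two sources.

*Posterior mean.* Near `θ*` each loss is Lipschitz at `θ*` with an integrable constant `G(x)`
(`RegularModel.exists_lipschitz`), so replacing `θ*` by `θ̂` moves the sample mean of the losses by
at most `‖θ̂ - θ*‖` times the average of `G`, which is `O_p(1/√n)`. The prior moves it by a further
`O_p(1/n)`. The same constant controls the sample variances, because `∑ G(X_i)² ≤ (∑ G(X_i))²` and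
the factor `n` lost here is absorbed by `‖θ̂ - θ*‖² = O_p(1/n)`. Hence the diagonal of `Ψ_n` is
`O_p(n)` (`boundedInProb_postScale`).

*Spread of the posterior.* Given `Σ'`, the coordinate `μ'_j` has variance `Σ'_jj / λ_n` about
`μ_{n,j}`, so by Chebyshev's inequality it is enough that `Σ'_jj` is tight. Neither the normalising
constant nor the moments of the Wishart law are computed for this. Translating `W` to
`W + e_jj / M` preserves Lebesgue measure and maps the positive definite cone into itself, and where
`(W⁻¹)_jj > M` it at least doubles the determinant; comparing densities gives
`P((W⁻¹)_jj > M) ≤ 2 ^ (-(ν - K - 1) / 2) * exp (Ψ_jj / (2 M))` (`invWishart_diag_tail`), which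
vanishes for `ν = ν₀ + n` and `Ψ_jj = O(n)` once `M` is a large enough constant.
-/

namespace LaD

/-! ### A tail bound for the inverse-Wishart distribution -/

variable {K : ℕ}

theorem det_add_single (W : Matrix (Fin K) (Fin K) ℝ) (hW : IsUnit W.det) (j : Fin K) (t : ℝ) :
    (W + Matrix.single j j t).det = W.det * (1 + t * W⁻¹ j j) := by
  have h : Matrix.single j j t =
      Matrix.replicateCol Unit (Pi.single j t) *
        Matrix.replicateRow Unit (Pi.single j (1 : ℝ)) := by
    ext a b
    simp only [Matrix.single_apply, Matrix.mul_apply, Matrix.replicateCol_apply,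
      Matrix.replicateRow_apply, Pi.single_apply, Finset.univ_unique, Finset.sum_singleton]
    by_cases ha : a = j <;> by_cases hb : b = j <;> simp [ha, hb, Ne.symm]
  rw [h, Matrix.det_add_replicateCol_mul_replicateRow hW, Matrix.det_unique (n := Unit)]
  congr 1
  simp [Matrix.mul_apply, Matrix.replicateRow, Matrix.replicateCol, Pi.single_apply, mul_comm]

theorem symMatrix_add_single (v : {p : Fin K × Fin K // p.1 ≤ p.2} → ℝ) (j : Fin K) (t : ℝ) :
    symMatrix (v + Pi.single ⟨(j, j), le_rfl⟩ t) = symMatrix v + Matrix.single j j t := by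
  ext a b
  simp only [symMatrix, Matrix.of_apply, Pi.add_apply, Matrix.add_apply, Pi.single_apply,
    Matrix.single_apply, Subtype.mk.injEq, Prod.mk.injEq]
  congr 2
  apply propext
  constructor
  · rintro ⟨h1, h2⟩
    exact ⟨le_antisymm (h1.ge.trans (min_le_left a b)) ((le_max_left a b).trans h2.le) ,
      le_antisymm (h1.ge.trans (min_le_right a b)) ((le_max_right a b).trans h2.le) ⟩
  · rintro ⟨rfl, rfl⟩; simp

theorem measurable_symMatrix_inv :
    Measurable fun (v : {p : Fin K × Fin K // p.1 ≤ p.2} → ℝ) i j => (symMatrix v)⁻¹ i j := by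
  have hc : Continuous (symMatrix : ({p : Fin K × Fin K // p.1 ≤ p.2} → ℝ) → _) :=
    continuous_matrix fun i j => continuous_apply _
  refine measurable_pi_lambda _ fun i => measurable_pi_lambda _ fun j => ?_
  simp only [Matrix.inv_def, Ring.inverse_eq_inv', Matrix.smul_apply, smul_eq_mul]
  exact hc.matrix_det.measurable.inv.mul (hc.matrix_adjugate.matrix_elem i j).measurable

/-- The translation `W ↦ W + e_jj / M` multiplies `det W` by `1 + (W⁻¹)_jj / M`, which is at least
`2` where `(W⁻¹)_jj > M`, and adds `Ψ_jj / M` to the trace in the exponent. -/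
theorem wishartKernel_le_of_lt_inv {Ψ : Matrix (Fin K) (Fin K) ℝ} (hΨ : Ψ.PosDef) {ν : ℝ}
    (hν : (K : ℝ) + 1 ≤ ν) {M : ℝ} (hM : 0 < M) (j : Fin K)
    (v : {p : Fin K × Fin K // p.1 ≤ p.2} → ℝ) (hv : M < (symMatrix v)⁻¹ j j) :
    wishartKernel Ψ⁻¹ ν v ≤
      ENNReal.ofReal ((1 / 2) ^ ((ν - K - 1) / 2) * Real.exp (Ψ j j / (2 * M))) *
        wishartKernel Ψ⁻¹ ν (v + Pi.single ⟨(j, j), le_rfl⟩ M⁻¹) := by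
  unfold wishartKernel
  by_cases hW : (symMatrix v).PosDef
  swap
  · rw [Set.indicator_of_notMem (by exact hW)]; exact zero_le
  have hM' : 0 ≤ M⁻¹ := by positivity
  have hS : (Matrix.single j j M⁻¹).PosSemidef := by
    rw [← Matrix.diagonal_single]
    exact Matrix.PosSemidef.diagonal (by rw [Pi.single_nonneg]; exact hM')
  have hW' : (symMatrix (v + Pi.single ⟨(j, j), le_rfl⟩ M⁻¹)).PosDef := by
    rw [symMatrix_add_single]
    exact hW.add_posSemidef hS
  rw [Set.indicator_of_mem (by exact hW), Set.indicator_of_mem (by exact hW'),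
    ← ENNReal.ofReal_mul (by positivity)]
  apply ENNReal.ofReal_le_ofReal
  have hdet := hW.det_pos
  have hu : IsUnit Ψ.det := hΨ.det_pos.ne'.isUnit
  rw [symMatrix_add_single, det_add_single _ hdet.ne'.isUnit,
    Matrix.nonsing_inv_nonsing_inv _ hu, Matrix.mul_add, Matrix.trace_add]
  have htr : (Ψ * Matrix.single j j M⁻¹).trace = Ψ j j * M⁻¹ := by
    simp [Matrix.trace_mul_single]
  rw [htr]
  set D := (symMatrix v).det
  set a := (ν - K - 1) / 2
  have ha : 0 ≤ a := by simp only [a]; linarith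
  have h2 : 2 ≤ 1 + M⁻¹ * (symMatrix v)⁻¹ j j := by
    have : M⁻¹ * M ≤ M⁻¹ * (symMatrix v)⁻¹ j j := mul_le_mul_of_nonneg_left hv.le hM'
    rw [inv_mul_cancel₀ hM.ne'] at this
    linarith
  have h3 : D ^ a * 2 ^ a ≤ (D * (1 + M⁻¹ * (symMatrix v)⁻¹ j j)) ^ a := by
    rw [Real.mul_rpow hdet.le (by linarith)]
    gcongr
  have h4 : ((1 : ℝ) / 2) ^ a * 2 ^ a = 1 := by
    rw [← Real.mul_rpow (by norm_num) (by norm_num)]; norm_num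
  have h5 : Real.exp (-((Ψ * symMatrix v).trace + Ψ j j * M⁻¹) / 2) * Real.exp (Ψ j j / (2 * M))
      = Real.exp (-(Ψ * symMatrix v).trace / 2) := by
    rw [← Real.exp_add]; congr 1; field_simp; ring
  calc D ^ a * Real.exp (-(Ψ * symMatrix v).trace / 2)
      = ((1 / 2) ^ a * Real.exp (Ψ j j / (2 * M))) * ((D ^ a * 2 ^ a) *
        Real.exp (-((Ψ * symMatrix v).trace + Ψ j j * M⁻¹) / 2)) := by
        rw [← h5]
        linear_combination (-(D ^ a) * Real.exp (Ψ j j / (2 * M)) *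
          Real.exp (-((Ψ * symMatrix v).trace + Ψ j j * M⁻¹) / 2)) * h4
    _ ≤ _ := by gcongr

/-- A tail bound for the diagonal of an inverse-Wishart matrix. It follows from
`wishartKernel_le_of_lt_inv` by translation invariance of Lebesgue measure, and holds whatever the
value of the normalising constant. -/
theorem invWishart_diag_tail {Ψ : Matrix (Fin K) (Fin K) ℝ} (hΨ : Ψ.PosDef) {ν : ℝ}
    (hν : (K : ℝ) + 1 ≤ ν) {M : ℝ} (hM : 0 < M) (j : Fin K) :
    invWishart Ψ ν {s | M < s j j} ≤
      ENNReal.ofReal ((1 / 2) ^ ((ν - K - 1) / 2) * Real.exp (Ψ j j / (2 * M))) := by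
  have hms : MeasurableSet {s : Fin K → Fin K → ℝ | M < s j j} :=
    measurableSet_lt measurable_const (by fun_prop)
  rw [invWishart, Measure.map_apply measurable_symMatrix_inv hms, wishart, Measure.smul_apply,
    withDensity_apply _ (measurable_symMatrix_inv hms), smul_eq_mul]
  -- Only the pointwise comparison of the density with a translate of itself is used below.
  obtain ⟨e, hle⟩ : ∃ e : {p : Fin K × Fin K // p.1 ≤ p.2} → ℝ, ∀ v, M < (symMatrix v)⁻¹ j j →
      wishartKernel Ψ⁻¹ ν v ≤
        ENNReal.ofReal ((1 / 2) ^ ((ν - K - 1) / 2) * Real.exp (Ψ j j / (2 * M))) *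
          wishartKernel Ψ⁻¹ ν (v + e) := ⟨_, wishartKernel_le_of_lt_inv hΨ hν hM j⟩
  have hC : ENNReal.ofReal ((1 / 2) ^ ((ν - K - 1) / 2) * Real.exp (Ψ j j / (2 * M))) ≠ ⊤ :=
    ENNReal.ofReal_ne_top
  generalize ENNReal.ofReal ((1 / 2) ^ ((ν - K - 1) / 2) * Real.exp (Ψ j j / (2 * M))) = C
    at hle hC ⊢
  generalize wishartKernel Ψ⁻¹ ν = f at hle ⊢
  have key : ∫⁻ v in (fun v i j => (symMatrix v)⁻¹ i j) ⁻¹' {s | M < s j j}, f v ≤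
      C * ∫⁻ v, f v := by
    calc _ ≤ ∫⁻ v in (fun v i j => (symMatrix v)⁻¹ i j) ⁻¹' {s | M < s j j},
          C * f (v + e) :=
          setLIntegral_mono' (measurable_symMatrix_inv hms) hle
      _ ≤ ∫⁻ v, C * f (v + e) :=
          setLIntegral_le_lintegral _ _
      _ = C * ∫⁻ v, f v := by
          rw [lintegral_const_mul' _ _ hC, lintegral_add_right_eq_self (μ := volume) f]
  generalize ∫⁻ v, f v = I at key ⊢
  calc I⁻¹ * _ ≤ I⁻¹ * (C * I) := by gcongr
    _ = C * (I⁻¹ * I) := by ring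
    _ ≤ C * 1 := by gcongr; exact ENNReal.inv_mul_le_one _
    _ = C := mul_one _

/-- Chebyshev for one coordinate; positive semidefiniteness of `S` is not required. -/
theorem multivariateGaussian_coord_tail (m : EuclideanSpace ℝ (Fin K))
    (S : Matrix (Fin K) (Fin K) ℝ) (j : Fin K) {V η : ℝ} (hV : S j j ≤ V) (hη : 0 < η) :
    multivariateGaussian m S {x | η ≤ |x j - m j|} ≤ ENNReal.ofReal (V / η ^ 2) := by
  -- A covariance that is not positive semidefinite gives the point mass at `m`, by convention.
  by_cases hS : S.PosSemidef
  · have hmem : MemLp (fun x : EuclideanSpace ℝ (Fin K) => x j) 2 (multivariateGaussian m S) :=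
      IsGaussian.memLp_two_id.eval_piLp j
    have h := meas_ge_le_variance_div_sq hmem hη
    have hmean : ∫ x, x j ∂multivariateGaussian m S = m j := by
      have := (EuclideanSpace.proj (𝕜 := ℝ) j).integral_comp_comm
        (IsGaussian.integrable_id (μ := multivariateGaussian m S))
      simpa using this
    rw [hmean, variance_eval_multivariateGaussian hS] at h
    exact h.trans (ENNReal.ofReal_le_ofReal (by gcongr))
  · rw [multivariateGaussian_of_not_posSemidef _ hS,
      Measure.dirac_apply' _ (measurableSet_le measurable_const (by fun_prop))]
    simp [hη]

/-! ### Boundedness in probability -/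

section BoundedInProb

variable {Ω : Type*} [MeasurableSpace Ω] {Pr : Measure Ω} {Y Y' : ℕ → Ω → ℝ}

/-- `Y_n = O_p(1)`. -/
def BoundedInProb (Pr : Measure Ω) (Y : ℕ → Ω → ℝ) : Prop :=
  IsBigOInProb Pr Y fun _ => 1

theorem BoundedInProb.exists_pos (h : BoundedInProb Pr Y) {ε : ℝ} (hε : 0 < ε) :
    ∃ M : ℝ, 0 < M ∧ ∀ᶠ n in atTop, Pr {ω | M < |Y n ω|} ≤ ENNReal.ofReal ε := by
  obtain ⟨M, hM⟩ := h ε hε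
  refine ⟨max M 1, by positivity, hM.mono fun n hn => (measure_mono fun ω hω => ?_).trans hn⟩
  simp only [Set.mem_ofPred_eq, mul_one] at hω ⊢
  exact (le_max_left _ _).trans_lt hω

theorem boundedInProb_of_pos
    (h : ∀ ε : ℝ, 0 < ε → ∃ M : ℝ, ∀ᶠ n in atTop, Pr {ω | M < |Y n ω|} ≤ ENNReal.ofReal ε) :
    BoundedInProb Pr Y := by
  intro ε hε
  simpa using h ε hε

theorem tendsto_measure_zero_of_real {A : ℕ → Set Ω}
    (h : ∀ ε : ℝ, 0 < ε → ∀ᶠ n in atTop, Pr (A n) ≤ ENNReal.ofReal ε) :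
    Tendsto (fun n => Pr (A n)) atTop (𝓝 0) := by
  rw [ENNReal.tendsto_nhds_zero]
  intro ε hε
  rcases eq_or_ne ε ⊤ with rfl | htop
  · exact Eventually.of_forall fun _ => le_top
  · rw [← ENNReal.ofReal_toReal htop]
    exact h _ (ENNReal.toReal_pos hε.ne' htop)

/-- Domination outside events `A n` of vanishing probability preserves `O_p(1)`. -/
theorem BoundedInProb.of_le_on (h : BoundedInProb Pr Y) {A : ℕ → Set Ω}
    (hA : Tendsto (fun n => Pr (A n)) atTop (𝓝 0))
    (hle : ∀ᶠ n in atTop, ∀ ω ∉ A n, |Y' n ω| ≤ |Y n ω|) : BoundedInProb Pr Y' := by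
  refine boundedInProb_of_pos fun ε hε => ?_
  obtain ⟨M, -, hM⟩ := h.exists_pos (half_pos hε)
  refine ⟨M, ?_⟩
  have hA' := ENNReal.tendsto_nhds_zero.1 hA (ENNReal.ofReal (ε / 2)) (by simpa using hε)
  filter_upwards [hM, hA', hle] with n h1 h2 h3
  calc Pr {ω | M < |Y' n ω|} ≤ Pr ({ω | M < |Y n ω|} ∪ A n) := measure_mono fun ω hω => by
        by_cases hωA : ω ∈ A n
        · exact Or.inr hωA
        · exact Or.inl (lt_of_lt_of_le hω (h3 ω hωA))
    _ ≤ Pr {ω | M < |Y n ω|} + Pr (A n) := measure_union_le _ _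
    _ ≤ ENNReal.ofReal (ε / 2) + ENNReal.ofReal (ε / 2) := add_le_add h1 h2
    _ = ENNReal.ofReal ε := by
        rw [← ENNReal.ofReal_add (by positivity) (by positivity), add_halves]

theorem BoundedInProb.of_le (h : BoundedInProb Pr Y)
    (hle : ∀ᶠ n in atTop, ∀ ω, |Y' n ω| ≤ |Y n ω|) : BoundedInProb Pr Y' :=
  h.of_le_on (A := fun _ => ∅) (by simp) (hle.mono fun _ hn ω _ => hn ω)

theorem boundedInProb_const (C : ℝ) : BoundedInProb Pr fun _ _ => C := by
  refine boundedInProb_of_pos fun ε _ => ⟨|C|, Eventually.of_forall fun n => ?_⟩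
  simp

theorem BoundedInProb.comp₂ (h : BoundedInProb Pr Y) (h' : BoundedInProb Pr Y')
    {f : ℝ → ℝ → ℝ} {g : ℝ → ℝ → ℝ}
    (hf : ∀ a b A B : ℝ, 0 < A → 0 < B → |a| ≤ A → |b| ≤ B → |f a b| ≤ g A B) :
    BoundedInProb Pr fun n ω => f (Y n ω) (Y' n ω) := by
  refine boundedInProb_of_pos fun ε hε => ?_
  obtain ⟨M, hM0, hM⟩ := h.exists_pos (half_pos hε)
  obtain ⟨M', hM0', hM'⟩ := h'.exists_pos (half_pos hε)
  refine ⟨g M M', ?_⟩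
  filter_upwards [hM, hM'] with n h1 h2
  calc Pr {ω | g M M' < |f (Y n ω) (Y' n ω)|}
      ≤ Pr ({ω | M < |Y n ω|} ∪ {ω | M' < |Y' n ω|}) := measure_mono fun ω hω => by
        by_contra hcon
        simp only [Set.mem_union, Set.mem_ofPred_eq, not_or, not_lt] at hcon hω
        exact absurd (hf _ _ _ _ hM0 hM0' hcon.1 hcon.2) (not_le.2 hω)
    _ ≤ Pr {ω | M < |Y n ω|} + Pr {ω | M' < |Y' n ω|} := measure_union_le _ _
    _ ≤ ENNReal.ofReal (ε / 2) + ENNReal.ofReal (ε / 2) := add_le_add h1 h2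
    _ = ENNReal.ofReal ε := by
        rw [← ENNReal.ofReal_add (by positivity) (by positivity), add_halves]

theorem BoundedInProb.add (h : BoundedInProb Pr Y) (h' : BoundedInProb Pr Y') :
    BoundedInProb Pr fun n ω => Y n ω + Y' n ω :=
  h.comp₂ h' (f := fun a b => a + b) (g := fun A B => A + B) fun a b _ _ _ _ h1 h2 =>
    (abs_add_le a b).trans (add_le_add h1 h2)

theorem BoundedInProb.mul (h : BoundedInProb Pr Y) (h' : BoundedInProb Pr Y') :
    BoundedInProb Pr fun n ω => Y n ω * Y' n ω :=
  h.comp₂ h' (f := fun a b => a * b) (g := fun A B => A * B) fun a b _ _ hA _ h1 h2 => by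
    rw [abs_mul]
    exact mul_le_mul h1 h2 (abs_nonneg _) hA.le

theorem BoundedInProb.abs (h : BoundedInProb Pr Y) : BoundedInProb Pr fun n ω => |Y n ω| :=
  h.of_le (Eventually.of_forall fun n ω => (abs_abs (Y n ω)).le)

theorem BoundedInProb.tendsto_measure_mul (h : BoundedInProb Pr Y) {a : ℕ → ℝ}
    (ha : Tendsto a atTop (𝓝 0)) {η : ℝ} (hη : 0 < η) :
    Tendsto (fun n => Pr {ω | η ≤ |a n * Y n ω|}) atTop (𝓝 0) := by
  refine tendsto_measure_zero_of_real fun ε hε => ?_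
  obtain ⟨M, hM0, hM⟩ := h.exists_pos hε
  have ha' : ∀ᶠ n in atTop, |a n| < η / M := by
    have := ha.abs
    rw [abs_zero] at this
    exact this.eventually_lt_const (by positivity)
  filter_upwards [hM, ha'] with n h1 h2
  refine (measure_mono fun ω hω => ?_).trans h1
  simp only [Set.mem_ofPred_eq, abs_mul] at hω ⊢
  by_contra hcon
  rw [not_lt] at hcon
  have h3 : |a n| * |Y n ω| ≤ |a n| * M := mul_le_mul_of_nonneg_left hcon (abs_nonneg _)
  have h4 : |a n| * M < η := (lt_div_iff₀ hM0).1 h2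
  linarith

theorem boundedInProb_of_integral_le (hint : ∀ n, Integrable (Y n) Pr) (h0 : ∀ n ω, 0 ≤ Y n ω)
    {C : ℝ} (hC : ∀ᶠ n in atTop, ∫ ω, Y n ω ∂Pr ≤ C) : BoundedInProb Pr Y := by
  refine boundedInProb_of_pos fun ε hε => ⟨(|C| + 1) / ε, hC.mono fun n hn => ?_⟩
  have hM : 0 < (|C| + 1) / ε := by positivity
  have h1 := mul_meas_ge_le_integral_of_nonneg (ae_of_all _ (h0 n)) (hint n) ((|C| + 1) / ε)
  have hreal : Pr.real {ω | (|C| + 1) / ε ≤ Y n ω} ≤ ε := by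
    have h2 : (|C| + 1) / ε * Pr.real {ω | (|C| + 1) / ε ≤ Y n ω} ≤ (|C| + 1) / ε * ε := by
      rw [div_mul_cancel₀ _ hε.ne']
      linarith [le_abs_self C]
    exact le_of_mul_le_mul_left h2 hM
  have hfin : Pr {ω | (|C| + 1) / ε ≤ Y n ω} ≠ ⊤ := ((hint n).measure_ge_lt_top hM).ne
  calc Pr {ω | (|C| + 1) / ε < |Y n ω|} ≤ Pr {ω | (|C| + 1) / ε ≤ Y n ω} :=
        measure_mono fun ω hω => by
          rw [Set.mem_ofPred_eq, abs_of_nonneg (h0 n ω)] at hω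
          exact hω.le
    _ ≤ ENNReal.ofReal ε := ENNReal.le_ofReal_iff_toReal_le hfin hε.le |>.2 hreal

end BoundedInProb

/-! ### Concentration of a normal-inverse-Wishart draw -/

/-- A bound on the conditional probability that `(z, Y) ∈ S` given `Z = z`, uniform in `z`, bounds
the probability that `(Z, Y) ∈ S`. -/
theorem measure_le_of_condDistrib_le {Ω 𝓩 E : Type*} [MeasurableSpace Ω] [MeasurableSpace 𝓩]
    [MeasurableSpace E] [StandardBorelSpace E] [Nonempty E] {Pr : Measure Ω}
    [IsProbabilityMeasure Pr] {Z : Ω → 𝓩} {Y : Ω → E} (hZ : Measurable Z) (hY : Measurable Y)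
    {S : Set (𝓩 × E)} (hS : MeasurableSet S) {ε : ℝ≥0∞}
    (h : ∀ᵐ z ∂(Pr.map Z), condDistrib Y Z Pr z (Prod.mk z ⁻¹' S) ≤ ε) :
    Pr {ω | (Z ω, Y ω) ∈ S} ≤ ε := by
  have : IsProbabilityMeasure (Pr.map Z) := Measure.isProbabilityMeasure_map hZ.aemeasurable
  calc Pr {ω | (Z ω, Y ω) ∈ S} = (Pr.map fun ω => (Z ω, Y ω)) S :=
        (Measure.map_apply (hZ.prodMk hY) hS).symm
    _ = ((Pr.map Z) ⊗ₘ condDistrib Y Z Pr) S := by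
        rw [compProd_map_condDistrib hY.aemeasurable]
    _ = ∫⁻ z, condDistrib Y Z Pr z (Prod.mk z ⁻¹' S) ∂(Pr.map Z) := Measure.compProd_apply hS
    _ ≤ ∫⁻ _, ε ∂(Pr.map Z) := lintegral_mono_ae h
    _ = ε := by simp

/-- Deviation of a coordinate of the draw from its conditional mean. The three terms account for a
large scale matrix, a large `Sig` given a moderate scale matrix, and a large deviation of `mu` given
a moderate `Sig`. -/
theorem IsNIWDraw.measure_le {Ω 𝓩 : Type*} [MeasurableSpace Ω] [MeasurableSpace 𝓩] {K : ℕ}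
    {Pr : Measure Ω} [IsProbabilityMeasure Pr] {Z : Ω → 𝓩} {m : 𝓩 → Fin K → ℝ} {l : ℝ}
    {Ψ : 𝓩 → Matrix (Fin K) (Fin K) ℝ} {ν : ℝ}
    {mu : Ω → EuclideanSpace ℝ (Fin K)} {Sig : Ω → Fin K → Fin K → ℝ}
    (h : IsNIWDraw Pr Z m l Ψ ν mu Sig) (hZ : Measurable Z) (hm : Measurable m) (hl : 0 < l)
    (hΨ : ∀ z, (Ψ z).PosDef) (hΨm : ∀ j, Measurable fun z => Ψ z j j)
    (hν : (K : ℝ) + 1 ≤ ν) {M η : ℝ} (hM : 0 < M) (hη : 0 < η) (R : ℝ) (j : Fin K) :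
    Pr {ω | η ≤ |mu ω j - m (Z ω) j|} ≤ Pr {ω | R < Ψ (Z ω) j j} +
      ENNReal.ofReal ((1 / 2) ^ ((ν - K - 1) / 2) * Real.exp (R / (2 * M))) +
      ENNReal.ofReal (M / l / η ^ 2) := by
  have hSig : Pr {ω | (Z ω, Sig ω) ∈ {p : 𝓩 × (Fin K → Fin K → ℝ) | Ψ p.1 j j ≤ R ∧ M < p.2 j j}} ≤
      ENNReal.ofReal ((1 / 2) ^ ((ν - K - 1) / 2) * Real.exp (R / (2 * M))) := by
    refine measure_le_of_condDistrib_le hZ h.measurable_Sig ?_ ?_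
    · have hs : Measurable fun p : 𝓩 × (Fin K → Fin K → ℝ) => p.2 j j := by fun_prop
      exact (measurableSet_le ((hΨm j).comp measurable_fst) measurable_const).inter
        (measurableSet_lt measurable_const hs)
    · filter_upwards [h.law_Sig] with z hz
      rw [hz]
      by_cases hzR : Ψ z j j ≤ R
      · refine (measure_mono fun s hs => hs.2).trans
          ((invWishart_diag_tail (hΨ z) hν hM j).trans ?_)
        gcongr
      · rw [show Prod.mk z ⁻¹' {p : 𝓩 × (Fin K → Fin K → ℝ) | Ψ p.1 j j ≤ R ∧ M < p.2 j j} = ∅ by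
          ext s; simp [hzR]]
        simp
  have hmu : Pr {ω | ((Z ω, Sig ω), mu ω) ∈
      {q : (𝓩 × (Fin K → Fin K → ℝ)) × EuclideanSpace ℝ (Fin K) |
        q.1.2 j j ≤ M ∧ η ≤ |q.2 j - m q.1.1 j|}} ≤ ENNReal.ofReal (M / l / η ^ 2) := by
    refine measure_le_of_condDistrib_le (hZ.prodMk h.measurable_Sig) h.measurable_mu ?_ ?_
    · have hs : Measurable fun q : (𝓩 × (Fin K → Fin K → ℝ)) × EuclideanSpace ℝ (Fin K) =>
          q.1.2 j j := by fun_prop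
      have hd : Measurable fun q : (𝓩 × (Fin K → Fin K → ℝ)) × EuclideanSpace ℝ (Fin K) =>
          |q.2 j - m q.1.1 j| := by fun_prop
      exact (measurableSet_le hs measurable_const).inter (measurableSet_le measurable_const hd)
    · filter_upwards [h.law_mu] with p hp
      rw [hp]
      by_cases hpM : p.2 j j ≤ M
      · refine (measure_mono fun s hs => hs.2).trans
          (multivariateGaussian_coord_tail _ _ j ?_ hη)
        rw [Matrix.smul_apply, Matrix.of_apply, smul_eq_mul, one_div_mul_eq_div]
        gcongr
      · rw [show Prod.mk p ⁻¹' {q : (𝓩 × (Fin K → Fin K → ℝ)) × EuclideanSpace ℝ (Fin K) |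
            q.1.2 j j ≤ M ∧ η ≤ |q.2 j - m q.1.1 j|} = ∅ by ext s; simp [hpM]]
        simp
  calc Pr {ω | η ≤ |mu ω j - m (Z ω) j|}
      ≤ Pr (({ω | R < Ψ (Z ω) j j} ∪ {ω | Ψ (Z ω) j j ≤ R ∧ M < Sig ω j j}) ∪
          {ω | Sig ω j j ≤ M ∧ η ≤ |mu ω j - m (Z ω) j|}) := measure_mono fun ω hω => by
        simp only [Set.mem_union, Set.mem_ofPred_eq] at hω ⊢
        rcases lt_or_ge R (Ψ (Z ω) j j) with h1 | h1
        · exact Or.inl (Or.inl h1)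
        rcases lt_or_ge M (Sig ω j j) with h2 | h2
        · exact Or.inl (Or.inr ⟨h1, h2⟩)
        · exact Or.inr ⟨h2, hω⟩
    _ ≤ _ := (measure_union_le _ _).trans (add_le_add (measure_union_le _ _) le_rfl)
    _ ≤ _ := add_le_add (add_le_add le_rfl hSig) hmu

/-! ### The deterministic limit of the estimate -/

section Deterministic

variable {K : ℕ}

theorem abs_iInf_sub_iInf_le {ι : Type*} [Finite ι] [Nonempty ι] {u v : ι → ℝ} {η : ℝ}
    (h : ∀ j, |u j - v j| ≤ η) : |(⨅ j, u j) - ⨅ j, v j| ≤ η := by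
  have aux : ∀ u v : ι → ℝ, (∀ j, |u j - v j| ≤ η) → (⨅ j, u j) - η ≤ ⨅ j, v j := fun u v h =>
    le_ciInf fun j => by
      have h1 := ciInf_le (Set.finite_range u).bddBelow j
      have h2 := abs_le.1 (h j)
      linarith
  have h1 := aux u v h
  have h2 := aux v u fun j => abs_sub_comm (u j) (v j) ▸ h j
  rw [abs_le]
  constructor <;> linarith

variable {ι : Type*} {F : Filter ι} {m : ι → Fin K → ℝ} {μ : Fin K → ℝ}

theorem tendsto_iInf_of_finite {κ : Type*} [Finite κ] [Nonempty κ] {u : ι → κ → ℝ} {v : κ → ℝ}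
    (h : ∀ j, Tendsto (fun i => u i j) F (𝓝 (v j))) :
    Tendsto (fun i => ⨅ j, u i j) F (𝓝 (⨅ j, v j)) := by
  rw [Metric.tendsto_nhds]
  intro ε hε
  have : ∀ᶠ i in F, ∀ j, |u i j - v j| ≤ ε / 2 := eventually_all.2 fun j =>
    ((Metric.tendsto_nhds.1 (h j)) (ε / 2) (by positivity)).mono fun i hi => hi.le
  filter_upwards [this] with i hi
  exact (abs_iInf_sub_iInf_le hi).trans_lt (half_lt_self hε)

theorem eventually_deltaOptimal_eq {δ : ℝ} (hδ : ∀ k, δ ≠ μ k - ⨅ j, μ j)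
    (hm : ∀ j, Tendsto (fun i => m i j) F (𝓝 (μ j))) :
    ∀ᶠ i in F, deltaOptimal δ (m i) = deltaOptimal δ μ := by
  have key : ∀ k, ∀ᶠ i in F, (k ∈ deltaOptimal δ (m i) ↔ k ∈ deltaOptimal δ μ) := by
    intro k
    have : Nonempty (Fin K) := ⟨k⟩
    have hlim : Tendsto (fun i => m i k - ⨅ j, m i j) F (𝓝 (μ k - ⨅ j, μ j)) :=
      (hm k).sub (tendsto_iInf_of_finite hm)
    simp only [deltaOptimal, Set.mem_ofPred_eq]
    rcases lt_or_gt_of_ne (hδ k) with h | h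
    · filter_upwards [hlim.eventually_const_lt h] with i hi
      constructor <;> intro <;> linarith
    · filter_upwards [hlim.eventually_lt_const h] with i hi
      constructor <;> intro <;> linarith
  filter_upwards [eventually_all.2 key] with i hi
  exact Set.ext hi

theorem tendsto_softScore {c : Fin K → ℝ≥0} {a : ι → ℝ} (ha : Tendsto a F atTop)
    (hm : ∀ j, Tendsto (fun i => m i j) F (𝓝 (μ j)))
    (ham : ∀ j, Tendsto (fun i => a i * (m i j - μ j)) F (𝓝 0)) (k : Fin K) :
    Tendsto (fun i => softScore c (a i) (m i) k) F
      (𝓝 (Set.indicator {k | ∀ j, c j = c k → μ k ≤ μ j} (fun _ => (1 : ℝ)) k)) := by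
  have : Nonempty {j // c j = c k} := ⟨⟨k, rfl⟩⟩
  by_cases hk : ∀ j, c j = c k → μ k ≤ μ j
  · rw [Set.indicator_of_mem (by exact hk), ← Real.exp_zero]
    refine (Real.continuous_exp.tendsto 0).comp ?_
    have hinf : μ k = ⨅ j : {j // c j = c k}, μ j :=
      le_antisymm (le_ciInf fun j => hk j j.2)
        (ciInf_le (Set.finite_range fun j : {j // c j = c k} => μ j).bddBelow ⟨k, rfl⟩)
    rw [Metric.tendsto_nhds]
    intro ε hε
    have hall : ∀ᶠ i in F, ∀ j, |a i * (m i j - μ j)| < ε / 2 := eventually_all.2 fun j => by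
      have := (ham j).abs
      rw [abs_zero] at this
      exact this.eventually_lt_const (by positivity)
    filter_upwards [hall, ha.eventually_gt_atTop 0] with i hi hai
    have hbd : ∀ j, |m i j - μ j| ≤ (Finset.univ.sup' ⟨k, Finset.mem_univ k⟩
        fun j => |m i j - μ j|) := fun j =>
      Finset.le_sup' (fun j => |m i j - μ j|) (Finset.mem_univ j)
    -- `j₀` is a coordinate in which `m i` is furthest from `μ`.
    obtain ⟨j₀, -, hj₀⟩ := Finset.exists_mem_eq_sup' ⟨k, Finset.mem_univ k⟩
      fun j => |m i j - μ j|
    rw [hj₀] at hbd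
    have h1 := abs_le.1 (abs_iInf_sub_iInf_le (u := fun j : {j // c j = c k} => m i j)
      (v := fun j => μ j) fun j => hbd j)
    have h2 := abs_le.1 (hbd k)
    have h3 : |m i k - ⨅ j : {j // c j = c k}, m i j| ≤ 2 * |m i j₀ - μ j₀| :=
      abs_le.2 ⟨by linarith, by linarith⟩
    have h4 := hi j₀
    rw [abs_mul, abs_of_pos hai] at h4
    rw [dist_zero_right, Real.norm_eq_abs, abs_mul, abs_neg, abs_of_pos hai]
    calc a i * |m i k - ⨅ j : {j // c j = c k}, m i j| ≤ a i * (2 * |m i j₀ - μ j₀|) := by gcongr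
      _ < ε := by linarith
  · rw [Set.indicator_of_notMem (by exact hk)]
    refine Real.tendsto_exp_atBot.comp ?_
    push Not at hk
    obtain ⟨j, hj, hlt⟩ := hk
    have hlim : Tendsto (fun i => m i k - ⨅ j : {j // c j = c k}, m i j) F
        (𝓝 (μ k - ⨅ j : {j // c j = c k}, μ j)) :=
      (hm k).sub (tendsto_iInf_of_finite fun j => hm j)
    have hpos : 0 < μ k - ⨅ j : {j // c j = c k}, μ j := by
      have := ciInf_le (Set.finite_range fun j : {j // c j = c k} => μ j).bddBelow ⟨j, hj⟩
      simp only at this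
      linarith
    have := (ha.atTop_mul_pos hpos hlim)
    simpa only [neg_mul, Function.comp_def] using tendsto_neg_atTop_atBot.comp this

/-- The deterministic limit of the estimate: draws that approach `μ` faster than `1 / a`, where
`a → ∞`, give the indicator of the best models of `μ`. -/
theorem tendsto_slcEst {T : ℕ} (hT : 0 < T) {c : Fin K → ℝ≥0} {δ : ℝ}
    (hδ : ∀ k, δ ≠ μ k - ⨅ j, μ j) {a : ι → ℝ} (ha : Tendsto a F atTop)
    {m : ι → Fin T → Fin K → ℝ}
    (ham : ∀ t j, Tendsto (fun i => a i * (m i t j - μ j)) F (𝓝 0)) (k : Fin K) :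
    Tendsto (fun i => slcEst c δ (a i) (m i) k) F
      (𝓝 (Set.indicator (bestModels c δ μ) (fun _ => (1 : ℝ)) k)) := by
  have hT0 : (T : ℝ) ≠ 0 := by positivity
  have h1 : ∀ t j, Tendsto (fun i => m i t j - μ j) F (𝓝 0) := fun t j => by
    have := ha.inv_tendsto_atTop.mul (ham t j)
    rw [mul_zero] at this
    refine this.congr' ?_
    filter_upwards [ha.eventually_ne_atTop 0] with i hi
    exact inv_mul_cancel_left₀ hi _
  have hm : ∀ t j, Tendsto (fun i => m i t j) F (𝓝 (μ j)) := fun t j => by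
    simpa using (h1 t j).add_const (μ j)
  have hbetween : ∀ᶠ i in F, betweenEst c δ (m i) k =
      Set.indicator {μ | minComplexity c δ μ = c k} (fun _ => (1 : ℝ)) μ := by
    filter_upwards [eventually_all.2 fun t => eventually_deltaOptimal_eq hδ (hm t)] with i hi
    have : ∀ t, Set.indicator {μ | minComplexity c δ μ = c k} (fun _ => (1 : ℝ)) (m i t) =
        Set.indicator {μ | minComplexity c δ μ = c k} (fun _ => (1 : ℝ)) μ := fun t => by
      simp only [Set.indicator_apply, Set.mem_ofPred_eq, minComplexity, hi t]
    simp only [betweenEst, this, Finset.sum_const, Finset.card_univ, Fintype.card_fin, nsmul_eq_mul]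
    field_simp
  have hwithin : Tendsto (fun i => withinEst c (a i) (m i) k) F
      (𝓝 (Set.indicator {k | ∀ j, c j = c k → μ k ≤ μ j} (fun _ => (1 : ℝ)) k)) := by
    have := (tendsto_finsetSum Finset.univ fun t _ =>
      tendsto_softScore (c := c) ha (hm t) (ham t) k).const_mul (1 / (T : ℝ))
    rw [Finset.sum_const, Finset.card_univ, Fintype.card_fin, nsmul_eq_mul, ← mul_assoc,
      one_div_mul_cancel hT0, one_mul] at this
    exact this
  have hlim : Set.indicator (bestModels c δ μ) (fun _ => (1 : ℝ)) k =
      Set.indicator {μ | minComplexity c δ μ = c k} (fun _ => (1 : ℝ)) μ *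
        Set.indicator {k | ∀ j, c j = c k → μ k ≤ μ j} (fun _ => (1 : ℝ)) k := by
    by_cases hk : c k = minComplexity c δ μ
    · simp [Set.indicator_apply, bestModels, hk]
    · simp [Set.indicator_apply, bestModels, hk, Ne.symm hk]
  rw [hlim]
  exact (tendsto_const_nhds.congr' (hbetween.mono fun i hi => hi.symm)).mul hwithin

end Deterministic

/-! ### Local Lipschitz bound for the losses -/

/-- Near `θs` the loss is Lipschitz at `θs`, with an integrable constant: the second derivative
bound controls the variation of the gradient on the ball, and `‖∇ℓ‖ ≤ 1 + ‖∇ℓ‖²` bounds the gradient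
at `θs` by an integrable function. -/
theorem RegularModel.exists_lipschitz {𝓧 : Type*} [MeasurableSpace 𝓧] {P : Measure 𝓧}
    [IsProbabilityMeasure P] {d : ℕ}
    {Θ : Set (EuclideanSpace ℝ (Fin d))} {ℓ : 𝓧 → EuclideanSpace ℝ (Fin d) → ℝ}
    {θs : EuclideanSpace ℝ (Fin d)} (h : RegularModel P Θ ℓ θs) :
    ∃ r > 0, ∃ G : 𝓧 → ℝ, (∀ x, 0 ≤ G x) ∧ Integrable G P ∧
      ∀ x, ∀ θ ∈ Metric.ball θs r, |ℓ x θ - ℓ x θs| ≤ G x * ‖θ - θs‖ := by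
  obtain ⟨r, hr, -, -, hC, H, hH0, hHint, hH⟩ := h.locallyRegular
  refine ⟨r, hr, fun x => (1 + ‖∇ (ℓ x) θs‖ ^ 2) + H x * r, fun x => ?_, ?_, fun x θ hθ => ?_⟩
  · have := hH0 x
    positivity
  · exact ((integrable_const 1).add h.gradient_sq).add (hHint.mul_const r)
  have hcenter : θs ∈ Metric.ball θs r := Metric.mem_ball_self hr
  have hat : ∀ y ∈ Metric.ball θs r, ContDiffAt ℝ 2 (ℓ x) y := fun y hy =>
    (hC x).contDiffAt (Metric.isOpen_ball.mem_nhds hy)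
  have hdd : ∀ y ∈ Metric.ball θs r, DifferentiableAt ℝ (fderiv ℝ (ℓ x)) y := fun y hy =>
    ((hat y hy).fderiv_right (m := 1) (by norm_num)).differentiableAt (by norm_num)
  have hdd_le : ∀ y ∈ Metric.ball θs r, ‖fderiv ℝ (fderiv ℝ (ℓ x)) y‖ ≤ H x := fun y hy => by
    rw [← norm_iteratedFDeriv_one, norm_iteratedFDeriv_fderiv]
    exact hH x y hy
  have hgrad : ‖fderiv ℝ (ℓ x) θs‖ = ‖∇ (ℓ x) θs‖ := by
    rw [gradient, LinearIsometryEquiv.norm_map]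
  have hd_le : ∀ y ∈ Metric.ball θs r,
      ‖fderiv ℝ (ℓ x) y‖ ≤ (1 + ‖∇ (ℓ x) θs‖ ^ 2) + H x * r := fun y hy => by
    have h1 := (convex_ball θs r).norm_image_sub_le_of_norm_fderiv_le hdd hdd_le hcenter hy
    have h2 : ‖y - θs‖ ≤ r := (mem_ball_iff_norm.1 hy).le
    have h3 : H x * ‖y - θs‖ ≤ H x * r := mul_le_mul_of_nonneg_left h2 (hH0 x)
    have h4 := norm_le_norm_add_norm_sub' (fderiv ℝ (ℓ x) y) (fderiv ℝ (ℓ x) θs)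
    nlinarith [sq_nonneg (‖∇ (ℓ x) θs‖ - 1)]
  exact (convex_ball θs r).norm_image_sub_le_of_norm_fderiv_le
    (fun y hy => (hat y hy).differentiableAt (by norm_num)) hd_le hcenter hθ

/-! ### Averages of independent observations -/

section Averages

variable {𝓧 Ω : Type*} [MeasurableSpace 𝓧] [MeasurableSpace Ω] {P : Measure 𝓧}
  {Pr : Measure Ω} {X : ℕ → Ω → 𝓧}

theorem boundedInProb_average (hX : ∀ i, MeasurePreserving (X i) Pr P) {g : 𝓧 → ℝ}
    (hg : Integrable g P) (h0 : ∀ x, 0 ≤ g x) :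
    BoundedInProb Pr fun n ω => (1 / (n : ℝ)) * ∑ i : Fin n, g (X i ω) := by
  have hint : ∀ i, Integrable (fun ω => g (X i ω)) Pr := fun i =>
    (hX i).integrable_comp_of_integrable hg
  have hval : ∀ i, ∫ ω, g (X i ω) ∂Pr = ∫ x, g x ∂P := fun i => by
    rw [← (hX i).map_eq]
    refine (integral_map (hX i).measurable.aemeasurable ?_).symm
    rw [(hX i).map_eq]
    exact hg.aestronglyMeasurable
  refine boundedInProb_of_integral_le (C := ∫ x, g x ∂P)
    (fun n => (integrable_finsetSum _ fun (i : Fin n) _ => hint i).const_mul _)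
    (fun n ω => mul_nonneg (by positivity) (Finset.sum_nonneg fun i _ => h0 _)) ?_
  filter_upwards [eventually_gt_atTop 0] with n hn
  rw [integral_const_mul, integral_finsetSum _ fun (i : Fin n) _ => hint i]
  simp only [hval, Finset.sum_const, Finset.card_univ, Fintype.card_fin, nsmul_eq_mul]
  rw [← mul_assoc, one_div_mul_cancel (by positivity), one_mul]

/-- The `√n`-rate in the weak law of large numbers, from the variance of the average. -/
theorem boundedInProb_sqrt_mul_average_sub (hX : ∀ i, MeasurePreserving (X i) Pr P)
    [IsProbabilityMeasure Pr] (hindep : iIndepFun X Pr) {f : 𝓧 → ℝ}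
    (hfm : Measurable f) (hf : MemLp f 2 P) :
    BoundedInProb Pr fun n ω =>
      √(n : ℝ) * ((1 / (n : ℝ)) * ∑ i : Fin n, f (X i ω) - ∫ x, f x ∂P) := by
  have hmem : ∀ i, MemLp (fun ω => f (X i ω)) 2 Pr := fun i => hf.comp_measurePreserving (hX i)
  have hmean : ∀ i, ∫ ω, f (X i ω) ∂Pr = ∫ x, f x ∂P := fun i => by
    rw [← (hX i).map_eq]
    exact (integral_map (hX i).measurable.aemeasurable hfm.aestronglyMeasurable).symm
  have hvar : ∀ i, Var[fun ω => f (X i ω); Pr] = Var[f; P] := fun i => by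
    rw [← (hX i).map_eq, variance_map hfm.aemeasurable (hX i).measurable.aemeasurable]
    rfl
  have hmemS : ∀ n, MemLp (fun ω => ∑ i : Fin n, f (X i ω)) 2 Pr := fun n =>
    memLp_finsetSum _ fun i _ => hmem i
  have hsq : BoundedInProb Pr fun n ω =>
      (√(n : ℝ) * ((1 / (n : ℝ)) * ∑ i : Fin n, f (X i ω) - ∫ x, f x ∂P)) ^ 2 := by
    refine boundedInProb_of_integral_le (C := Var[f; P]) (fun n => ?_) (fun n ω => sq_nonneg _) ?_
    · exact ((((hmemS n).const_mul _).sub (memLp_const _)).const_mul _).integrable_sq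
    filter_upwards [eventually_gt_atTop 0] with n hn
    have hn' : (n : ℝ) ≠ 0 := by positivity
    have hES : ∫ ω, ∑ i : Fin n, f (X i ω) ∂Pr = n * ∫ x, f x ∂P := by
      rw [integral_finsetSum _ fun (i : Fin n) _ => (hmem i).integrable (by norm_num)]
      simp [hmean]
    have hVS : Var[fun ω => ∑ i : Fin n, f (X i ω); Pr] = n * Var[f; P] := by
      have := IndepFun.variance_sum (μ := Pr) (X := fun (i : Fin n) ω => f (X i ω))
        (s := Finset.univ) (fun i _ => hmem i) fun i _ j _ hij =>
          (hindep.indepFun (Fin.val_injective.ne hij)).comp hfm hfm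
      simpa [hvar, Finset.sum_fn] using this
    rw [variance_eq_integral (hmemS n).aestronglyMeasurable.aemeasurable, hES] at hVS
    have : ∀ ω, (√(n : ℝ) * ((1 / (n : ℝ)) * ∑ i : Fin n, f (X i ω) - ∫ x, f x ∂P)) ^ 2 =
        (1 / (n : ℝ)) * (∑ i : Fin n, f (X i ω) - n * ∫ x, f x ∂P) ^ 2 := fun ω => by
      rw [mul_pow, Real.sq_sqrt (Nat.cast_nonneg n)]
      field_simp
    simp only [this]
    rw [integral_const_mul, hVS, ← mul_assoc, one_div_mul_cancel hn', one_mul]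
  refine ((boundedInProb_const 1).add hsq).of_le (Eventually.of_forall fun n ω => ?_)
  generalize √(n : ℝ) * ((1 / (n : ℝ)) * ∑ i : Fin n, f (X i ω) - ∫ x, f x ∂P) = u
  rw [abs_of_nonneg (by positivity : 0 ≤ 1 + u ^ 2)]
  exact abs_le.2 ⟨by nlinarith [sq_nonneg (u + 1)], by nlinarith [sq_nonneg (u - 1)]⟩

end Averages

/-! ### Perturbation of sample means and variances -/

section Perturbation

variable {n : ℕ} {y g z : Fin n → ℝ} {t β : ℝ}

theorem abs_sqrt_mul_average_sub_le (hn : 0 < n) (h : ∀ i, |z i - y i| ≤ g i * t + β) (μ : ℝ) :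
    |√(n : ℝ) * ((1 / (n : ℝ)) * ∑ i, z i - μ)| ≤
      |√(n : ℝ) * ((1 / (n : ℝ)) * ∑ i, y i - μ)| +
        ((√(n : ℝ) * t) * ((1 / (n : ℝ)) * ∑ i, g i) + √(n : ℝ) * β) := by
  have hn' : (n : ℝ) ≠ 0 := by positivity
  have h1 : √(n : ℝ) * ((1 / (n : ℝ)) * ∑ i, z i - μ) =
      √(n : ℝ) * ((1 / (n : ℝ)) * ∑ i, y i - μ) +
        √(n : ℝ) * ((1 / (n : ℝ)) * ∑ i, (z i - y i)) := by
    rw [Finset.sum_sub_distrib]; ring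
  rw [h1]
  refine (abs_add_le _ _).trans (add_le_add le_rfl ?_)
  rw [abs_mul, abs_mul, abs_of_nonneg (Real.sqrt_nonneg _),
    abs_of_nonneg (by positivity : 0 ≤ 1 / (n : ℝ))]
  calc √(n : ℝ) * (1 / (n : ℝ) * |∑ i, (z i - y i)|)
      ≤ √(n : ℝ) * (1 / (n : ℝ) * ∑ i, (g i * t + β)) := by
        gcongr
        exact (Finset.abs_sum_le_sum_abs _ _).trans (Finset.sum_le_sum fun i _ => h i)
    _ = _ := by
        rw [Finset.sum_add_distrib, ← Finset.sum_mul]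
        simp only [Finset.sum_const, Finset.card_univ, Fintype.card_fin, nsmul_eq_mul]
        field_simp

/-- Sample variance of a perturbed sample. Only the sum of the `g i` enters, through
`∑ g i ^ 2 ≤ (∑ g i) ^ 2`; the resulting factor `n` is carried by `√n * t`. -/
theorem average_sq_sub_average_le (hn : 0 < n) (h : ∀ i, |z i - y i| ≤ g i * t + β)
    (hg : ∀ i, 0 ≤ g i) (μ : ℝ) :
    (1 / (n : ℝ)) * ∑ i, (z i - (1 / (n : ℝ)) * ∑ i, z i) ^ 2 ≤
      3 * ((1 / (n : ℝ)) * ∑ i, (y i - μ) ^ 2 +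
        ((√(n : ℝ) * t) * ((1 / (n : ℝ)) * ∑ i, g i)) ^ 2 + β ^ 2) := by
  have hn' : (n : ℝ) ≠ 0 := by positivity
  -- The average minimises the sum of squared deviations.
  have hmin : ∑ i, (z i - (1 / (n : ℝ)) * ∑ i, z i) ^ 2 ≤ ∑ i, (z i - μ) ^ 2 := by
    set S := ∑ i, z i with hS
    have hexp : ∀ a : ℝ, ∑ i, (z i - a) ^ 2 = ∑ i, z i ^ 2 - 2 * a * S + n * a ^ 2 := fun a => by
      simp only [sub_sq, Finset.sum_add_distrib, Finset.sum_sub_distrib, Finset.sum_const,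
        Finset.card_univ, Fintype.card_fin, nsmul_eq_mul]
      rw [hS, Finset.mul_sum]
      congr 2
      exact Finset.sum_congr rfl fun i _ => by ring
    rw [hexp, hexp]
    have : 0 ≤ (1 / (n : ℝ)) * (S - n * μ) ^ 2 := by positivity
    have h2 : (1 / (n : ℝ)) * (S - n * μ) ^ 2 = (- 2 * μ * S + n * μ ^ 2) -
      (- 2 * (1 / (n : ℝ) * S) * S + n * (1 / (n : ℝ) * S) ^ 2) := by field_simp; ring
    linarith
  have hpt : ∀ i, (z i - μ) ^ 2 ≤ 3 * ((y i - μ) ^ 2 + t ^ 2 * g i ^ 2 + β ^ 2) := fun i => by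
    have h1 : |z i - μ| ≤ |y i - μ| + g i * t + β := by
      have := abs_sub_le (z i) (y i) μ
      have := h i
      linarith
    have h2 := pow_le_pow_left₀ (abs_nonneg _) h1 2
    rw [sq_abs] at h2
    rw [← sq_abs (y i - μ)]
    nlinarith [sq_nonneg (|y i - μ| - g i * t), sq_nonneg (|y i - μ| - β),
      sq_nonneg (g i * t - β)]
  have hgsq : ∑ i, g i ^ 2 ≤ (∑ i, g i) ^ 2 :=
    Finset.sum_sq_le_sq_sum_of_nonneg fun i _ => hg i
  have hs : (√(n : ℝ) * t * (1 / (n : ℝ) * ∑ i, g i)) ^ 2 =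
      (1 / (n : ℝ)) * (t ^ 2 * (∑ i, g i) ^ 2) := by
    rw [mul_pow, mul_pow, Real.sq_sqrt (Nat.cast_nonneg n)]
    field_simp
  calc (1 / (n : ℝ)) * ∑ i, (z i - (1 / (n : ℝ)) * ∑ i, z i) ^ 2
      ≤ (1 / (n : ℝ)) * ∑ i, 3 * ((y i - μ) ^ 2 + t ^ 2 * g i ^ 2 + β ^ 2) :=
        mul_le_mul_of_nonneg_left (hmin.trans (Finset.sum_le_sum fun i _ => hpt i)) (by positivity)
    _ = 3 * ((1 / (n : ℝ)) * ∑ i, (y i - μ) ^ 2 + (1 / (n : ℝ)) * (t ^ 2 * ∑ i, g i ^ 2) +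
        β ^ 2) := by
        rw [← Finset.mul_sum, Finset.sum_add_distrib, Finset.sum_add_distrib, ← Finset.mul_sum]
        simp only [Finset.sum_const, Finset.card_univ, Fintype.card_fin, nsmul_eq_mul]
        field_simp
    _ ≤ _ := by
        rw [hs]
        gcongr

end Perturbation

/-! ### Sample statistics and rates -/

theorem sampleMean_apply {n K : ℕ} (z : Fin n → Fin K → ℝ) (k : Fin K) :
    sampleMean z k = (1 / (n : ℝ)) * ∑ i, z i k := by
  simp [sampleMean]

theorem sampleCov_diag {n K : ℕ} (z : Fin n → Fin K → ℝ) (k : Fin K) :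
    sampleCov z k k =
      (1 / (n : ℝ)) * ∑ i, (z i k - (1 / (n : ℝ)) * ∑ i, z i k) ^ 2 := by
  simp [sampleCov, Matrix.sum_apply, Matrix.vecMulVec_apply, sampleMean_apply, sq]

theorem IsBigOInProb.sqrt_mul {Ω : Type*} [MeasurableSpace Ω] {Pr : Measure Ω} {Y : ℕ → Ω → ℝ}
    (h : IsBigOInProb Pr Y fun n => 1 / √(n : ℝ)) :
    BoundedInProb Pr fun n ω => √(n : ℝ) * Y n ω := by
  refine boundedInProb_of_pos fun ε hε => ?_
  obtain ⟨M, hM⟩ := h ε hε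
  refine ⟨M, ?_⟩
  filter_upwards [hM, eventually_gt_atTop 0] with n hn hpos
  refine (measure_mono fun ω hω => ?_).trans hn
  have hs : 0 < √(n : ℝ) := by positivity
  simp only [Set.mem_ofPred_eq, abs_mul, abs_of_pos hs] at hω ⊢
  rwa [mul_one_div, div_lt_iff₀' hs]

theorem tendsto_one_div_sqrt : Tendsto (fun n : ℕ => 1 / √(n : ℝ)) atTop (𝓝 0) := by
  simp only [one_div]
  exact (Real.tendsto_sqrt_atTop.comp tendsto_natCast_atTop_atTop).inv_tendsto_atTop

theorem one_le_sqrt_and_sqrt_le_self {n : ℕ} (hn : 0 < n) : 1 ≤ √(n : ℝ) ∧ √(n : ℝ) ≤ n := by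
  have h1 : (1 : ℝ) ≤ n := by exact_mod_cast hn
  have h2 : 1 ≤ √(n : ℝ) := Real.one_le_sqrt.2 h1
  exact ⟨h2, by nlinarith [Real.mul_self_sqrt (Nat.cast_nonneg (α := ℝ) n)]⟩

/-! ### The matrix of loss values at the estimated parameters -/

section LossMatrix

variable {𝓧 Ω : Type*} [MeasurableSpace 𝓧] [MeasurableSpace Ω] {P : Measure 𝓧}
  {Pr : Measure Ω} {X : ℕ → Ω → 𝓧}
  {K : ℕ} {d : Fin K → ℕ} {Θ : ∀ k, Set (EuclideanSpace ℝ (Fin (d k)))}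
  {ℓ : ∀ k, 𝓧 → EuclideanSpace ℝ (Fin (d k)) → ℝ}
  {θs : ∀ k, EuclideanSpace ℝ (Fin (d k))}
  {θhat : ∀ k, ∀ n : ℕ, (Fin n → 𝓧) → EuclideanSpace ℝ (Fin (d k))} {k : Fin K}

theorem RegularModel.measurable_comp (hreg : RegularModel P (Θ k) (ℓ k) (θs k)) {α : Type*}
    [MeasurableSpace α] {u : α → 𝓧} {v : α → EuclideanSpace ℝ (Fin (d k))} (hu : Measurable u)
    (hv : Measurable v) (hmem : ∀ a, v a ∈ Θ k) : Measurable fun a => ℓ k (u a) (v a) :=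
  hreg.measurable_loss.comp (hu.prodMk (hv.subtype_mk (h := hmem)))

/-- Outside events of vanishing probability, on which `θ̂` is far from `θs`, the loss values at `θ̂`
differ from those at `θs` by an integrable function of the observation times `‖θ̂ - θs‖`, up to the
bias correction. -/
theorem exists_ladMatrix_perturbation [IsProbabilityMeasure P]
    (hX : ∀ i, MeasurePreserving (X i) Pr P)
    (hreg : RegularModel P (Θ k) (ℓ k) (θs k))
    (hrate : IsBigOInProb Pr (fun n ω => ‖θhat k n (fun i => X i ω) - θs k‖)
      (fun n => 1 / √(n : ℝ))) (b : Fin K → ℝ) :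
    ∃ (G : 𝓧 → ℝ) (A : ℕ → Set Ω), (∀ x, 0 ≤ G x) ∧
      BoundedInProb Pr (fun n ω => (√(n : ℝ) * ‖θhat k n (fun i => X i ω) - θs k‖) *
        ((1 / (n : ℝ)) * ∑ i : Fin n, G (X i ω))) ∧
      Tendsto (fun n => Pr (A n)) atTop (𝓝 0) ∧
      ∀ n, ∀ ω ∉ A n, ∀ i, |ladMatrix ℓ θhat b n (fun i => X i ω) i k - ℓ k (X i ω) (θs k)| ≤
        G (X i ω) * ‖θhat k n (fun i => X i ω) - θs k‖ + |b k| / (2 * n) := by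
  obtain ⟨r, hr, G, hG0, hGint, hG⟩ := hreg.exists_lipschitz
  have hT := hrate.sqrt_mul
  refine ⟨G, fun n => {ω | r ≤ ‖θhat k n (fun i => X i ω) - θs k‖}, hG0,
    hT.mul (boundedInProb_average hX hGint hG0), ?_, fun n ω hω i => ?_⟩
  · refine (hT.tendsto_measure_mul tendsto_one_div_sqrt hr).congr' ?_
    filter_upwards [eventually_gt_atTop 0] with n hn
    have hs : √(n : ℝ) ≠ 0 := by positivity
    congr 1
    ext ω
    rw [Set.mem_ofPred_eq, Set.mem_ofPred_eq, ← mul_assoc, one_div_mul_cancel hs, one_mul,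
      abs_norm]
  · simp only [Set.mem_ofPred_eq, not_le] at hω
    have h1 := hG (X i ω) _ (mem_ball_iff_norm.2 hω)
    have h2 : |b k / (2 * n)| = |b k| / (2 * n) := by
      rw [abs_div, abs_of_nonneg (by positivity : (0 : ℝ) ≤ 2 * n)]
    rw [← h2, ladMatrix, add_sub_right_comm]
    exact (abs_add_le _ _).trans (add_le_add h1 le_rfl)

theorem boundedInProb_sampleMean [IsProbabilityMeasure P] [IsProbabilityMeasure Pr]
    (hX : ∀ i, MeasurePreserving (X i) Pr P)
    (hindep : iIndepFun X Pr) (hreg : RegularModel P (Θ k) (ℓ k) (θs k))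
    (hrate : IsBigOInProb Pr (fun n ω => ‖θhat k n (fun i => X i ω) - θs k‖)
      (fun n => 1 / √(n : ℝ)))
    (hmom : MemLp (fun x => ℓ k x (θs k)) 2 P) (b : Fin K → ℝ) :
    BoundedInProb Pr fun n ω => √(n : ℝ) *
      (sampleMean (ladMatrix ℓ θhat b n (fun i => X i ω)) k - trueMean P ℓ θs k) := by
  obtain ⟨G, A, hG0, hGb, hA, hbd⟩ := exists_ladMatrix_perturbation hX hreg hrate b
  have hfm : Measurable fun x => ℓ k x (θs k) :=
    hreg.measurable_comp measurable_id measurable_const fun _ => hreg.mem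
  have hU := boundedInProb_sqrt_mul_average_sub hX hindep hfm hmom
  refine (hU.abs.add (hGb.abs.add (boundedInProb_const |b k|))).of_le_on hA ?_
  filter_upwards [eventually_gt_atTop 0] with n hn ω hω
  rw [sampleMean_apply]
  refine (abs_sqrt_mul_average_sub_le hn (hbd n ω hω) _).trans ?_
  have hβ : √(n : ℝ) * (|b k| / (2 * n)) ≤ |b k| := by
    have hn' : (0 : ℝ) < n := by positivity
    rw [← mul_div_assoc, div_le_iff₀ (by positivity)]
    nlinarith [mul_le_mul_of_nonneg_right (one_le_sqrt_and_sqrt_le_self hn).2 (abs_nonneg (b k)),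
      mul_nonneg hn'.le (abs_nonneg (b k))]
  refine le_trans ?_ (le_abs_self _)
  exact add_le_add le_rfl (add_le_add (le_abs_self _) hβ)

theorem boundedInProb_sampleCov [IsProbabilityMeasure P]
    (hX : ∀ i, MeasurePreserving (X i) Pr P)
    (hreg : RegularModel P (Θ k) (ℓ k) (θs k))
    (hrate : IsBigOInProb Pr (fun n ω => ‖θhat k n (fun i => X i ω) - θs k‖)
      (fun n => 1 / √(n : ℝ)))
    (hmom : MemLp (fun x => ℓ k x (θs k)) 2 P) (b : Fin K → ℝ) :
    BoundedInProb Pr fun n ω => sampleCov (ladMatrix ℓ θhat b n (fun i => X i ω)) k k := by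
  obtain ⟨G, A, hG0, hGb, hA, hbd⟩ := exists_ladMatrix_perturbation hX hreg hrate b
  have hV := boundedInProb_average hX
    (g := fun x => (ℓ k x (θs k) - trueMean P ℓ θs k) ^ 2)
    (hmom.sub (memLp_const _)).integrable_sq fun x => sq_nonneg _
  refine ((boundedInProb_const 3).mul
    ((hV.add (hGb.mul hGb)).add (boundedInProb_const (b k ^ 2)))).of_le_on hA ?_
  filter_upwards [eventually_gt_atTop 0] with n hn ω hω
  have h0 : 0 ≤ sampleCov (ladMatrix ℓ θhat b n (fun i => X i ω)) k k := by
    rw [sampleCov_diag]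
    positivity
  rw [abs_of_nonneg h0, sampleCov_diag]
  refine (average_sq_sub_average_le hn (hbd n ω hω) (fun i => hG0 _)
    (trueMean P ℓ θs k)).trans (le_trans ?_ (le_abs_self _))
  have hβ : (|b k| / (2 * n)) ^ 2 ≤ b k ^ 2 := by
    have hn' : (1 : ℝ) ≤ n := by exact_mod_cast hn
    rw [← sq_abs (b k)]
    exact pow_le_pow_left₀ (by positivity) (div_le_self (abs_nonneg _) (by linarith)) 2
  rw [sq (_ * _ : ℝ)]
  gcongr

theorem boundedInProb_postMean [IsProbabilityMeasure P] [IsProbabilityMeasure Pr]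
    (hX : ∀ i, MeasurePreserving (X i) Pr P)
    (hindep : iIndepFun X Pr) (hreg : RegularModel P (Θ k) (ℓ k) (θs k))
    (hrate : IsBigOInProb Pr (fun n ω => ‖θhat k n (fun i => X i ω) - θs k‖)
      (fun n => 1 / √(n : ℝ)))
    (hmom : MemLp (fun x => ℓ k x (θs k)) 2 P) (b : Fin K → ℝ) (m₀ : Fin K → ℝ) {l₀ : ℝ}
    (hl₀ : 0 < l₀) :
    BoundedInProb Pr fun n ω => √(n : ℝ) *
      (postMean m₀ l₀ (ladMatrix ℓ θhat b n (fun i => X i ω)) k - trueMean P ℓ θs k) := by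
  have hU := boundedInProb_sampleMean hX hindep hreg hrate hmom b
  refine ((boundedInProb_const (l₀ * |m₀ k - trueMean P ℓ θs k|)).add hU.abs).of_le ?_
  filter_upwards [eventually_gt_atTop 0] with n hn ω
  have hn' : (0 : ℝ) < n := by positivity
  have hs := one_le_sqrt_and_sqrt_le_self hn
  set μ := trueMean P ℓ θs k
  have hpm : √(n : ℝ) * (postMean m₀ l₀ (ladMatrix ℓ θhat b n (fun i => X i ω)) k - μ) =
      (√(n : ℝ) / (l₀ + n)) * (l₀ * (m₀ k - μ)) + (n / (l₀ + n)) *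
        (√(n : ℝ) * (sampleMean (ladMatrix ℓ θhat b n (fun i => X i ω)) k - μ)) := by
    simp only [postMean, Pi.smul_apply, Pi.add_apply, smul_eq_mul]
    field_simp
    ring
  rw [hpm, abs_of_nonneg (a := _ + |_|) (by positivity)]
  refine (abs_add_le _ _).trans ?_
  rw [abs_mul, abs_mul _ (√(n : ℝ) * _), abs_mul l₀, abs_of_pos hl₀,
    abs_of_nonneg (by positivity : 0 ≤ √(n : ℝ) / (l₀ + n)),
    abs_of_nonneg (by positivity : 0 ≤ (n : ℝ) / (l₀ + n))]
  refine add_le_add (mul_le_of_le_one_left (by positivity) ?_)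
    (mul_le_of_le_one_left (abs_nonneg _) ?_)
  · exact (div_le_one (by positivity)).2 (by linarith)
  · exact (div_le_one (by positivity)).2 (by linarith)

theorem boundedInProb_postScale [IsProbabilityMeasure P] [IsProbabilityMeasure Pr]
    (hX : ∀ i, MeasurePreserving (X i) Pr P)
    (hindep : iIndepFun X Pr) (hreg : RegularModel P (Θ k) (ℓ k) (θs k))
    (hrate : IsBigOInProb Pr (fun n ω => ‖θhat k n (fun i => X i ω) - θs k‖)
      (fun n => 1 / √(n : ℝ)))
    (hmom : MemLp (fun x => ℓ k x (θs k)) 2 P) (b : Fin K → ℝ) (m₀ : Fin K → ℝ) {l₀ : ℝ}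
    (hl₀ : 0 < l₀) (Ψ₀ : Matrix (Fin K) (Fin K) ℝ) :
    BoundedInProb Pr fun n ω => (1 / (n : ℝ)) *
      postScale m₀ l₀ Ψ₀ (ladMatrix ℓ θhat b n (fun i => X i ω)) k k := by
  have hU := (boundedInProb_sampleMean hX hindep hreg hrate hmom b).abs.add
    (boundedInProb_const |trueMean P ℓ θs k - m₀ k|)
  have hS := boundedInProb_sampleCov hX hreg hrate hmom b
  refine (((boundedInProb_const |Ψ₀ k k|).add hS.abs).add
    ((boundedInProb_const l₀).mul (hU.mul hU))).of_le ?_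
  filter_upwards [eventually_gt_atTop 0] with n hn ω
  have hn' : (1 : ℝ) ≤ n := by exact_mod_cast hn
  have hs := one_le_sqrt_and_sqrt_le_self hn
  set μ := trueMean P ℓ θs k
  set z := ladMatrix ℓ θhat b n (fun i => X i ω)
  have hps : (1 / (n : ℝ)) * postScale m₀ l₀ Ψ₀ z k k =
      (1 / n) * Ψ₀ k k + sampleCov z k k +
        (l₀ / (l₀ + n)) * ((sampleMean z k - m₀ k) * (sampleMean z k - m₀ k)) := by
    simp only [postScale, Matrix.add_apply, Matrix.smul_apply, smul_eq_mul,
      Matrix.vecMulVec_apply, Pi.sub_apply]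
    field_simp
  have hd : |sampleMean z k - m₀ k| ≤ |√(n : ℝ) * (sampleMean z k - μ)| + |μ - m₀ k| := by
    refine (abs_sub_le _ μ _).trans (add_le_add ?_ le_rfl)
    rw [abs_mul, abs_of_nonneg (Real.sqrt_nonneg _)]
    exact le_mul_of_one_le_left (abs_nonneg _) hs.1
  rw [hps]
  refine le_trans ?_ (le_abs_self _)
  refine (abs_add_three _ _ _).trans ?_
  rw [abs_mul, abs_mul (l₀ / _), abs_mul (sampleMean z k - m₀ k),
    abs_of_nonneg (by positivity : 0 ≤ 1 / (n : ℝ)),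
    abs_of_nonneg (by positivity : 0 ≤ l₀ / (l₀ + n))]
  have h1 : 1 / (n : ℝ) * |Ψ₀ k k| ≤ |Ψ₀ k k| :=
    mul_le_of_le_one_left (abs_nonneg _) ((div_le_one (by positivity)).2 hn')
  have h2 : l₀ / (l₀ + n) ≤ l₀ := div_le_self hl₀.le (by linarith)
  gcongr

end LossMatrix

/-! ### Posterior hyperparameters and draws -/

section Posterior

variable {n K : ℕ} {m₀ : Fin K → ℝ} {l₀ : ℝ}

theorem measurable_sampleMean : Measurable (sampleMean : (Fin n → Fin K → ℝ) → _) := by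
  unfold sampleMean
  fun_prop

theorem measurable_postMean :
    Measurable (postMean m₀ l₀ : (Fin n → Fin K → ℝ) → Fin K → ℝ) := by
  have := measurable_sampleMean (n := n) (K := K)
  unfold postMean
  fun_prop

theorem measurable_postScale_diag (Ψ₀ : Matrix (Fin K) (Fin K) ℝ) (j : Fin K) :
    Measurable fun z : Fin n → Fin K → ℝ => postScale m₀ l₀ Ψ₀ z j j := by
  have := measurable_sampleMean (n := n) (K := K)
  simp only [postScale, Matrix.add_apply, Matrix.smul_apply, smul_eq_mul, Matrix.vecMulVec_apply,
    Pi.sub_apply, sampleCov_diag]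
  fun_prop

theorem posDef_postScale (hl₀ : 0 < l₀) {Ψ₀ : Matrix (Fin K) (Fin K) ℝ} (hΨ₀ : Ψ₀.PosDef)
    (z : Fin n → Fin K → ℝ) : (postScale m₀ l₀ Ψ₀ z).PosDef := by
  have hvec : ∀ a : Fin K → ℝ, (Matrix.vecMulVec a a).PosSemidef := fun a => by
    simpa using Matrix.posSemidef_vecMulVec_self_star a
  have hcov : (sampleCov z).PosSemidef :=
    (Matrix.posSemidef_sum _ fun i _ => hvec _).smul (by positivity)
  exact (hΨ₀.add_posSemidef (hcov.smul (Nat.cast_nonneg n))).add_posSemidef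
    ((hvec _).smul (by positivity))

/-- A draw from the posterior is within `O_p(1/√n)` of the posterior mean, provided that the
diagonal entry of the scale matrix is `O_p(n)`. -/
theorem boundedInProb_draw_sub_postMean {Ω : Type*} [MeasurableSpace Ω] {Pr : Measure Ω}
    [IsProbabilityMeasure Pr] {Z : ∀ n : ℕ, Ω → Fin n → Fin K → ℝ} (hZ : ∀ n, Measurable (Z n))
    (hl₀ : 0 < l₀) {Ψ₀ : Matrix (Fin K) (Fin K) ℝ} (hΨ₀ : Ψ₀.PosDef) {ν₀ : ℝ}
    {mu : ℕ → Ω → EuclideanSpace ℝ (Fin K)} {Sig : ℕ → Ω → Fin K → Fin K → ℝ}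
    (hdraw : ∀ n, IsNIWDraw Pr (Z n) (postMean m₀ l₀) (l₀ + n) (postScale m₀ l₀ Ψ₀) (ν₀ + n)
      (mu n) (Sig n)) (j : Fin K)
    (hΨ : BoundedInProb Pr fun n ω => (1 / (n : ℝ)) * postScale m₀ l₀ Ψ₀ (Z n ω) j j) :
    BoundedInProb Pr fun n ω => √(n : ℝ) * (mu n ω j - postMean m₀ l₀ (Z n ω) j) := by
  refine boundedInProb_of_pos fun ε hε => ?_
  obtain ⟨R, hR0, hR⟩ := hΨ.exists_pos (ε := ε / 3) (by positivity)
  -- With `Ψ_jj ≤ R n` the inverse-Wishart bound is of order `2 ^ (-n / 2) * exp (R n / (2 M))`;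
  -- the choice `M = 2 R` makes this decay, as `1 / 4 < (log 2) / 2`.
  set M := 2 * R with hMdef
  have hM : 0 < M := by positivity
  -- Chebyshev at distance `B / √n` gives `M / B ^ 2`, which is `ε / 3`.
  set B := √(3 * M / ε) with hBdef
  have hB : 0 < B := by positivity
  have hB2 : M / B ^ 2 = ε / 3 := by
    rw [hBdef, Real.sq_sqrt (by positivity)]
    field_simp
  have hexp : ∀ᶠ n : ℕ in atTop, (1 / 2 : ℝ) ^ ((ν₀ + n - K - 1) / 2) *
      Real.exp (R * n / (2 * M)) ≤ ε / 3 := by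
    have hlog : (1 : ℝ) / 2 < Real.log 2 := by linarith [Real.log_two_gt_d9]
    have hlim : Tendsto (fun n : ℕ => -((ν₀ - K - 1) / 2) * Real.log 2 +
        (1 / 4 - Real.log 2 / 2) * (n : ℝ)) atTop atBot :=
      tendsto_atBot_add_const_left _ _
        (tendsto_natCast_atTop_atTop.const_mul_atTop_of_neg (by linarith))
    have := (Real.tendsto_exp_atBot.comp hlim).eventually_le_const (by positivity : 0 < ε / 3)
    filter_upwards [this] with n hn
    refine le_trans (le_of_eq ?_) hn
    rw [Real.rpow_def_of_pos (by norm_num), ← Real.exp_add, Function.comp_apply, one_div,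
      Real.log_inv, hMdef]
    congr 1
    field_simp
    ring
  refine ⟨B, ?_⟩
  have hν : ∀ᶠ n : ℕ in atTop, (K : ℝ) + 1 ≤ ν₀ + n :=
    (tendsto_atTop_add_const_left _ _ tendsto_natCast_atTop_atTop).eventually_ge_atTop _
  filter_upwards [hR, hexp, hν, eventually_gt_atTop 0] with n h1 h2 h3 hn
  have hn' : (0 : ℝ) < n := by positivity
  have hs : 0 < √(n : ℝ) := by positivity
  have hmain := (hdraw n).measure_le (hZ n) measurable_postMean (by positivity)
    (posDef_postScale hl₀ hΨ₀) (measurable_postScale_diag Ψ₀) h3 hM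
    (by positivity : 0 < B / √(n : ℝ)) (R * n) j
  calc Pr {ω | B < |√(n : ℝ) * (mu n ω j - postMean m₀ l₀ (Z n ω) j)|}
      ≤ Pr {ω | B / √(n : ℝ) ≤ |mu n ω j - postMean m₀ l₀ (Z n ω) j|} :=
        measure_mono fun ω hω => by
          simp only [Set.mem_ofPred_eq, abs_mul, abs_of_pos hs] at hω ⊢
          rw [div_le_iff₀' hs]
          exact hω.le
    _ ≤ _ := hmain
    _ ≤ ENNReal.ofReal (ε / 3) + ENNReal.ofReal (ε / 3) + ENNReal.ofReal (ε / 3) := by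
        refine add_le_add (add_le_add ((measure_mono fun ω hω => ?_).trans h1)
          (ENNReal.ofReal_le_ofReal h2)) (ENNReal.ofReal_le_ofReal ?_)
        · simp only [Set.mem_ofPred_eq] at hω ⊢
          refine lt_of_lt_of_le ?_ (le_abs_self _)
          rwa [one_div_mul_eq_div, lt_div_iff₀ hn']
        · rw [← hB2, div_pow, Real.sq_sqrt hn'.le]
          have : M / (l₀ + n) / (B ^ 2 / n) = (n / (l₀ + n)) * (M / B ^ 2) := by field_simp
          rw [this]
          exact mul_le_of_le_one_left (by positivity) ((div_le_one (by positivity)).2 (by linarith))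
    _ = ENNReal.ofReal ε := by
        rw [← ENNReal.ofReal_add (by positivity) (by positivity),
          ← ENNReal.ofReal_add (by positivity) (by positivity)]
        congr 1
        ring

end Posterior

/-! ### Convergence in probability -/

/-- Convergence in probability of the estimate, from `tendsto_slcEst` along the filter of pairs
`(n, m)` with `n → ∞` and `a n * (m - μ) → 0`. -/
theorem tendstoInMeasure_slcEst {Ω : Type*} [MeasurableSpace Ω] {Pr : Measure Ω} {K T : ℕ}
    (hT : 0 < T) {c : Fin K → ℝ≥0} {δ : ℝ} {μ : Fin K → ℝ} (hδ : ∀ k, δ ≠ μ k - ⨅ j, μ j)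
    {a : ℕ → ℝ} (ha : Tendsto a atTop atTop) {m : ℕ → Ω → Fin T → Fin K → ℝ}
    (hm : ∀ t j, ∀ η : ℝ, 0 < η →
      Tendsto (fun n => Pr {ω | η ≤ |a n * (m n ω t j - μ j)|}) atTop (𝓝 0)) (k : Fin K) :
    TendstoInMeasure Pr (fun n ω => slcEst c δ (a n) (m n ω) k) atTop
      (fun _ => Set.indicator (bestModels c δ μ) (fun _ => (1 : ℝ)) k) := by
  rw [tendstoInMeasure_iff_dist]
  intro ε hε
  set dev : ℕ × (Fin T → Fin K → ℝ) → Fin T → Fin K → ℝ :=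
    fun p t j => a p.1 * (p.2 t j - μ j) with hdev
  set F : Filter (ℕ × (Fin T → Fin K → ℝ)) := comap Prod.fst atTop ⊓ comap dev (𝓝 0)
  have hfst : Tendsto (fun p : ℕ × (Fin T → Fin K → ℝ) => p.1) F atTop :=
    tendsto_comap.mono_left inf_le_left
  have hdev0 : Tendsto dev F (𝓝 0) := tendsto_comap.mono_left inf_le_right
  have hslc := tendsto_slcEst (F := F) hT (c := c) hδ (ha.comp hfst) (m := fun p => p.2)
    (fun t j => tendsto_pi_nhds.1 (tendsto_pi_nhds.1 hdev0 t) j) k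
  have hev := Metric.tendsto_nhds.1 hslc ε hε
  have hbasis := (atTop_basis.comap (Prod.fst : ℕ × (Fin T → Fin K → ℝ) → ℕ)).inf
    ((Metric.nhds_basis_ball (x := (0 : Fin T → Fin K → ℝ))).comap dev)
  obtain ⟨⟨N, η⟩, ⟨-, hη⟩, hsub⟩ := hbasis.eventually_iff.1 hev
  simp only at hη hsub
  have hsum : Tendsto (fun n => ∑ t, ∑ j, Pr {ω | η ≤ |a n * (m n ω t j - μ j)|}) atTop (𝓝 0) := by
    have := tendsto_finsetSum (f := fun t n => ∑ j, Pr {ω | η ≤ |a n * (m n ω t j - μ j)|})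
      Finset.univ fun t _ => tendsto_finsetSum Finset.univ fun j _ => hm t j η hη
    simpa using this
  refine tendsto_of_tendsto_of_tendsto_of_le_of_le' tendsto_const_nhds hsum
    (Eventually.of_forall fun _ => zero_le) ?_
  filter_upwards [eventually_ge_atTop N] with n hn
  calc Pr {ω | ε ≤ dist (slcEst c δ (a n) (m n ω) k) _}
      ≤ Pr (⋃ t, ⋃ j, {ω | η ≤ |a n * (m n ω t j - μ j)|}) := measure_mono fun ω hω => by
        by_contra hcon
        simp only [Set.mem_iUnion, Set.mem_ofPred_eq, not_exists, not_le] at hcon hω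
        refine absurd (hsub (x := (n, m n ω)) ⟨hn, ?_⟩) (not_lt.2 hω)
        simp only [Set.mem_preimage, mem_ball_zero_iff]
        exact (pi_norm_lt_iff hη).2 fun t => (pi_norm_lt_iff hη).2 fun j => hcon t j
    _ ≤ ∑ t, Pr (⋃ j, {ω | η ≤ |a n * (m n ω t j - μ j)|}) := measure_iUnion_fintype_le _ _
    _ ≤ _ := Finset.sum_le_sum fun t _ => measure_iUnion_fintype_le _ _

end LaD

theorem mainTheorem2
    {𝓧 Ω : Type*} [MeasurableSpace 𝓧] [MeasurableSpace Ω]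
    (P : Measure 𝓧) [IsProbabilityMeasure P]
    (Pr : Measure Ω) [IsProbabilityMeasure Pr]
    -- i.i.d. observations with law `P`
    (X : ℕ → Ω → 𝓧) (hX_meas : ∀ i, Measurable (X i))
    (hX_indep : iIndepFun X Pr) (hX_law : ∀ i, Pr.map (X i) = P)
    -- the models, their losses, population minimisers and estimators
    {K : ℕ} (d : Fin K → ℕ)
    (Θ : ∀ k, Set (EuclideanSpace ℝ (Fin (d k))))
    (ℓ : ∀ k, 𝓧 → EuclideanSpace ℝ (Fin (d k)) → ℝ)
    (θs : ∀ k, EuclideanSpace ℝ (Fin (d k)))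
    (θhat : ∀ k, ∀ n : ℕ, (Fin n → 𝓧) → EuclideanSpace ℝ (Fin (d k)))
    (hreg : ∀ k, LaD.RegularModel P (Θ k) (ℓ k) (θs k))
    (hθhat_meas : ∀ k n, Measurable (θhat k n))
    (hθhat_mem : ∀ k n x, θhat k n x ∈ Θ k)
    (hθhat_rate : ∀ k, LaD.IsBigOInProb Pr
      (fun n ω => ‖θhat k n (fun i => X i ω) - θs k‖) (fun n => 1 / √(n : ℝ)))
    -- second moments of the losses
    (hmom : ∀ k, MemLp (fun x => ℓ k x (θs k)) 2 P)
    (hcov : (LaD.trueCov P ℓ θs).PosDef)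
    -- complexities, tolerance and temperature
    (c : Fin K → ℝ≥0) (δ : ℝ) (hδ : 0 ≤ δ)
    (hδ_ne : ∀ k, δ ≠ LaD.trueMean P ℓ θs k - ⨅ j, LaD.trueMean P ℓ θs j)
    (α : ℕ → ℝ) (hα_nonneg : ∀ n, 0 ≤ α n) (hα_top : Tendsto α atTop atTop)
    (hα_o : α =o[atTop] fun n : ℕ => √(n : ℝ))
    -- prior hyperparameters
    (m₀ : Fin K → ℝ) (l₀ : ℝ) (hl₀ : 0 < l₀)
    (Ψ₀ : Matrix (Fin K) (Fin K) ℝ) (hΨ₀ : Ψ₀.PosDef) (ν₀ : ℝ) (hν₀ : (K : ℝ) - 1 < ν₀)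
    -- the plain (`b = 0`) or bias-corrected (`b = d`) loss values
    (b : Fin K → ℝ) (hb : b = 0 ∨ b = fun k => (d k : ℝ))
    (Z : ∀ n : ℕ, Ω → Fin n → Fin K → ℝ)
    (hZ : ∀ n ω, Z n ω = LaD.ladMatrix ℓ θhat b n (fun i => X i ω))
    -- a fixed number `T` of draws from the posterior given the loss values
    (T : ℕ) (hT : 0 < T)
    (mu : ∀ n : ℕ, Fin T → Ω → EuclideanSpace ℝ (Fin K))
    (Sig : ∀ n : ℕ, Fin T → Ω → Fin K → Fin K → ℝ)
    (hdraw : ∀ n t, LaD.IsNIWDraw Pr (Z n) (LaD.postMean m₀ l₀) (l₀ + n)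
      (LaD.postScale m₀ l₀ Ψ₀) (ν₀ + n) (mu n t) (Sig n t))
    (k : Fin K) :
    TendstoInMeasure Pr
      (fun n ω => LaD.slcEst c δ (α n) (fun t => (mu n t ω).ofLp) k) atTop
      (fun _ => Set.indicator (LaD.bestModels c δ (LaD.trueMean P ℓ θs)) (fun _ => (1 : ℝ)) k) := by

  have hX : ∀ i, MeasurePreserving (X i) Pr P := fun i => ⟨hX_meas i, hX_law i⟩
  have hZm : ∀ n, Measurable (Z n) := fun n => by
    refine measurable_pi_lambda _ fun i => measurable_pi_lambda _ fun j => ?_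
    simp only [hZ, LaD.ladMatrix]
    refine Measurable.add_const ((hreg j).measurable_comp (hX_meas i) ?_
      fun ω => hθhat_mem j n _) _
    exact (hθhat_meas j n).comp (measurable_pi_lambda _ fun i => hX_meas i)
  have hratio : Tendsto (fun n : ℕ => α n / √(n : ℝ)) atTop (𝓝 0) := hα_o.tendsto_div_nhds_zero
  refine LaD.tendstoInMeasure_slcEst hT hδ_ne hα_top (fun t j η hη => ?_) k
  have hscale : LaD.BoundedInProb Pr fun n ω =>
      (1 / (n : ℝ)) * LaD.postScale m₀ l₀ Ψ₀ (Z n ω) j j := by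
    simp only [hZ]
    exact LaD.boundedInProb_postScale hX hX_indep (hreg j) (hθhat_rate j) (hmom j) b m₀ hl₀ Ψ₀
  have hmean : LaD.BoundedInProb Pr fun n ω => √(n : ℝ) *
      (LaD.postMean m₀ l₀ (Z n ω) j - LaD.trueMean P ℓ θs j) := by
    simp only [hZ]
    exact LaD.boundedInProb_postMean hX hX_indep (hreg j) (hθhat_rate j) (hmom j) b m₀ hl₀
  have hpost := LaD.boundedInProb_draw_sub_postMean hZm hl₀ hΨ₀ (fun n => hdraw n t) j hscale
  refine ((hpost.add hmean).tendsto_measure_mul hratio hη).congr' ?_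
  filter_upwards [eventually_gt_atTop 0] with n hn
  have hs : √(n : ℝ) ≠ 0 := by positivity
  congr 1
  ext ω
  rw [Set.mem_ofPred_eq, Set.mem_ofPred_eq, ← mul_add, sub_add_sub_cancel, ← mul_assoc,
    div_mul_cancel₀ _ hs]
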